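/- Let $n\ge 2$, let $e_1,\dots,e_{n+1}$ be the canonical basis of $\mathbb{R}^{n+1}$, and for $p=(p^1,\dots,p^{n+1})\in S^n\subset\mathbb{R}^{n+1}$ put $P_p(w):=w-(w\cdot p)p$. **The groupoid.** Let $G=SO_0(1,n+1)$, acting on $\mathbb{R}\times\mathbb{R}^{n}\times\mathbb{R}$, let $B=\{\mathrm{diag}(1,b): b\in SO(n+1)\}$ (elements of $B$ are identified with $b$), and let $C\subset G$ be the subgroup of the matrices $$(s,y):=\begin{pmatrix} \frac{s^2+1+|y|^2}{2s} & -\frac1s y^t & \frac{s^2-1+|y|^2}{2s}\\ -y & I & -y\\ \frac{s^2-1-|y|^2}{2s} & \frac1s y^t & \frac{s^2+1-|y|^2}{2s}\end{pmatrix},\qquad s>0,\ y\in\mathbb{R}^n,$$ so that $G=BC=CB$. On $G$ there is the groupoid $G_B$ with set of units $B$ and with multiplication graph $\{(c_1bc_2;\,c_1b,\,bc_2): b\in B,\ c_1,c_2\in C\}$. Let $$Z=TS^n\times\mathbb{R}_+=\{(p,v,s)\in\mathbb{R}^{n+1}\times\mathbb{R}^{n+1}\times\mathbb{R}: |p|=1,\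 p\cdot v=0,\ s>0\},$$ identified with $G_B/SO(n)$ (for right multiplication by $SO(n)=\{b\in B: be_{n+1}=e_{n+1}\}$) through $\pi: b\,(s,y)\mapsto\bigl(p=be_{n+1},\ v=b\binom{y}{0},\ s\bigr)$. The multiplication graph of $Z$ is the image under $\pi\times\pi\times\pi$ of that of $G_B$, and the set of units of $Z$ is $\pi(B)=S^n\times\{0\}\times\{1\}\cong S^n$. The left and right projections $\tilde e_L(z),\tilde e_R(z)$ are the units with $\tilde e_L(z)z=z=z\,\tilde e_R(z)$. The product $zw$ is defined when $\tilde e_R(z)=\tilde e_L(w)$. **The Lie algebroid.** The fibre of $\mathcal L(Z)$ at $p\in S^n$ is the tangent space at $(p,0,1)$ of the left fibre $\tilde e_L^{-1}(p,0,1)$. The left invariant extension of a section $X$ is the vector field on $Z$ whose value at $z$ is the image of $X(\tilde e_R(z))$ under the tangent map of the left translation $w\mapsto zw$. The bracket of two sections is the restriction to the units of the commutator of their left invariant extensions. The anchor $\rho$ at $p$ is the tangent map of $\tilde e_R$ at $(p,0,1)$, restricted to the fibre of $\mathcal L(Z)$. The triple $(p,\dot v,\dot s)$ denotes the velocity at $t=0$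 of the curve $t\mapsto(p,t\dot v,1+t\dot s)$. Put $$\tilde X_i(p):=(p,\;e_i-p^ip,\;p^i),\qquad i=1,\dots,n+1 .$$ **Proposition.** The units $\tilde e_L(z),\tilde e_R(z)$ exist and are unique for every $z\in Z$, and the product of two composable elements exists and is unique. The map $\tilde e_R$ and the left invariant extensions of $\tilde X_1,\dots,\tilde X_{n+1}$ are smooth on $Z$. Moreover, for every $p\in S^n$: 1. The fibre of $\mathcal L(Z)$ at $p$ is $\{(p,\dot v,\dot s): p\cdot\dot v=0,\ \dot s\in\mathbb{R}\}$, that is, $\mathcal L(Z)=TS^n\oplus\mathbb{R}$. The map $(p,\dot v,\dot s)\mapsto(p,\dot v+\dot s p)$ is a bijection of this fibre onto $\{p\}\times\mathbb{R}^{n+1}$, with inverse $(p,w)\mapsto(p,P_p(w),w\cdot p)$. The vectors $\tilde X_1(p),\dots,\tilde X_{n+1}(p)$ form a basis of the fibre. 2. The bracket is given at $p$ by $$[\tilde X_i,\tilde X_j]=2(p^j\tilde X_i-p^i\tilde X_j),\qquad i,j=1,\dots,n,$$ $$[\tilde X_i,\tilde X_{n+1}]=2(p^{n+1}\tilde X_i-p^i\tilde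 X_{n+1})-\tilde X_i+2p^i\sum_{k=1}^{n+1}p^k\tilde X_k,\qquad i=1,\dots,n.$$ 3. The anchor is given by $$\rho(\tilde X_i)(p)=-(1-p^{n+1})(e_i-p^ip)+p^i(e_{n+1}-p^{n+1}p)=P_p(p^ie_{n+1}+p^{n+1}e_i-e_i),\qquad i=1,\dots,n+1 .$$ 4. Under the identification $\mathcal L(Z)\cong S^n\times\mathbb{R}^{n+1}$ of item 1, the constant sections $\tilde e_i(p):=e_i$ satisfy $$[\tilde e_i,\tilde e_j](p)=2(p^je_i-p^ie_j),\qquad i,j=1,\dots,n,$$ $$[\tilde e_i,\tilde e_{n+1}](p)=2(p^{n+1}e_i-p^ie_{n+1})+(I-2P_p)(e_i),\qquad i=1,\dots,n,$$ and, for all $w\in\mathbb{R}^{n+1}$, $$\rho(p,w)=-(1-p^{n+1})P_p(w)+(p\cdot w)P_p(e_{n+1})=P_p\bigl((p\cdot e_{n+1})w+(p\cdot w)e_{n+1}-w\bigr).$$ -/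

import Mathlib

open scoped ContDiff RealInnerProductSpace

noncomputable section

namespace EuclideanLines

/-! ### The group `SO₀(1, n+1)` and its subgroups `B` and `C` -/

/-- Indices of the coordinates of `ℝⁿ⁺¹`: `Sum.inl i` are the first `n` ones and `Sum.inr ()` is
the last one, number `n + 1`. This is the block decomposition `p = (u, α)`, `v = (μ, r)`. -/
abbrev Idx (n : ℕ) : Type := Fin n ⊕ Unit

/-- Matrices of size `n + 2`; `Sum.inl ()` is the (timelike) coordinate number `0`. -/
abbrev Mat (n : ℕ) : Type := Matrix (Unit ⊕ Idx n) (Unit ⊕ Idx n) ℝ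

/-- The Minkowski form `diag(1, -1, …, -1)`. -/
def minkowski (n : ℕ) : Mat n := Matrix.fromBlocks 1 0 0 (-1)

/-- The group `G = SO₀(1, n+1)`: Lorentz matrices of determinant one that preserve the direction
of time. -/
def G (n : ℕ) : Set (Mat n) :=
  {g | g.transpose * minkowski n * g = minkowski n ∧ g.det = 1 ∧
    0 < g (Sum.inl ()) (Sum.inl ())}

/-- The embedding `b ↦ diag(1, b)` of `SO(n+1)` in `G`. -/
def rot (n : ℕ) (b : Matrix (Idx n) (Idx n) ℝ) : Mat n := Matrix.fromBlocks 1 0 0 b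

/-- The matrix denoted `(s, y)`, for `s > 0` and `y ∈ ℝⁿ`. The outer blocks split off coordinate
`0`, the inner ones split off the last coordinate. -/
def cMat (n : ℕ) (s : ℝ) (y : Fin n → ℝ) : Mat n :=
  Matrix.fromBlocks
    (Matrix.of fun _ _ => (s ^ 2 + 1 + y ⬝ᵥ y) / (2 * s))
    (Matrix.of fun _ => Sum.elim (fun j => -(1 / s) * y j)
      (fun _ => (s ^ 2 - 1 + y ⬝ᵥ y) / (2 * s)))
    (Matrix.of (Sum.elim (fun i _ => -y i)
      (fun _ _ => (s ^ 2 - 1 - y ⬝ᵥ y) / (2 * s))))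
    (Matrix.fromBlocks
      1
      (Matrix.of fun i _ => -y i)
      (Matrix.of fun _ j => 1 / s * y j)
      (Matrix.of fun _ _ => (s ^ 2 + 1 - y ⬝ᵥ y) / (2 * s)))

/-- The subgroup `B ≅ SO(n+1)`. -/
def B (n : ℕ) : Set (Mat n) :=
  {g | ∃ b ∈ Matrix.specialOrthogonalGroup (Idx n) ℝ, g = rot n b}

/-- The subgroup `C ≅ ℝ₊ ⋉ ℝⁿ`. -/
def C (n : ℕ) : Set (Mat n) :=
  {g | ∃ (s : ℝ) (y : Fin n → ℝ), 0 < s ∧ g = cMat n s y}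

/-- The graph of the multiplication of the groupoid `G_B : G ⇉ B`:
the triples `(c₁ b c₂; c₁ b, b c₂)`. -/
def MulB (n : ℕ) (g₃ g₁ g₂ : Mat n) : Prop :=
  g₁ ∈ G n ∧ g₂ ∈ G n ∧
    ∃ c₁ ∈ C n, ∃ b ∈ B n, ∃ c₂ ∈ C n, g₁ = c₁ * b ∧ g₂ = b * c₂ ∧ g₃ = c₁ * b * c₂

/-! ### The groupoid `Z = G_B / SO(n)`, realized on `TSⁿ × ℝ₊` -/

/-- The Euclidean space `ℝⁿ⁺¹`. -/
abbrev V (n : ℕ) : Type := EuclideanSpace ℝ (Idx n)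

/-- The space `ℝⁿ⁺¹ × ℝⁿ⁺¹ × ℝ`, in which `TSⁿ × ℝ₊` is an embedded submanifold. -/
abbrev E (n : ℕ) : Type := V n × V n × ℝ

/-- The canonical basis of `ℝⁿ⁺¹`. -/
def e (n : ℕ) (i : Idx n) : V n := EuclideanSpace.single i 1

/-- `Z = TSⁿ × ℝ₊ = {(p, v, s) : |p| = 1, p ⬝ v = 0, s > 0}`. -/
def Z (n : ℕ) : Set (E n) := {z | ‖z.1‖ = 1 ∧ ⟪z.1, z.2.1⟫ = 0 ∧ 0 < z.2.2}

/-- The graph of the canonical projection `π : G → Z`: for `g = b c` with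
`b = (Λ, u, w, α) ∈ B` and `c = (s, y) ∈ C`, `π(g) = (p, v, s)`, where `p = (u, α)` is the last
column of `b` and `v = (Λ y, wᵗ y) = b (y, 0)`. Its fibres are the orbits of `SO(n)` acting on `G`
by right multiplication. -/
def ProjZ (n : ℕ) (g : Mat n) (z : E n) : Prop :=
  g ∈ G n ∧ ∃ b ∈ Matrix.specialOrthogonalGroup (Idx n) ℝ, ∃ (s : ℝ) (y : Fin n → ℝ),
    0 < s ∧ g = rot n b * cMat n s y ∧
      z = (WithLp.toLp 2 (fun i => b i (Sum.inr ())),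
        WithLp.toLp 2 (b.mulVec (Sum.elim y (fun _ => 0))), s)

/-- The graph of the multiplication of the quotient groupoid `Z`: the image of the graph of the
multiplication of `G_B`; `MulRel n z₃ z₁ z₂` says that `z₃ = z₁ z₂`. -/
def MulRel (n : ℕ) (z₃ z₁ z₂ : E n) : Prop :=
  ∃ g₃ g₁ g₂ : Mat n, ProjZ n g₃ z₃ ∧ ProjZ n g₁ z₁ ∧ ProjZ n g₂ z₂ ∧ MulB n g₃ g₁ g₂

/-- The units of `Z`: the image of the set `B` of units of `G_B`. -/
def units (n : ℕ) : Set (E n) := {z | ∃ g ∈ B n, ProjZ n g z}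

/-- The left (target) projection: the unit `ε` with `ε z = z`. -/
def eL (n : ℕ) (z : E n) : E n := Classical.epsilon fun ε => ε ∈ units n ∧ MulRel n z ε z

/-- The right (source) projection: the unit `ε` with `z ε = z`. -/
def eR (n : ℕ) (z : E n) : E n := Classical.epsilon fun ε => ε ∈ units n ∧ MulRel n z z ε

/-- The product `z w` of composable elements. -/
def mul (n : ℕ) (z w : E n) : E n := Classical.epsilon fun z₃ => MulRel n z₃ z w

/-- The left fibre over a unit `ε`. -/
def leftFiber (n : ℕ) (ε : E n) : Set (E n) := {z | z ∈ Z n ∧ eL n z = ε}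

/-! ### The Lie algebroid of `Z`

Manifolds are embedded submanifolds `S` of `E n`. The tangent space of `S` at `x` is
`tangentConeAt ℝ S x`; a map on `S` is smooth if it is `ContDiffOn ℝ ∞` on `S`; its tangent map at
`x` is the restriction of `fderivWithin ℝ f S x` to the tangent space (it is on the tangent space
that a derivative within `S` is determined by `f`), and the commutator of vector fields on `S` is
`VectorField.lieBracketWithin ℝ X Y S`. -/

/-- The unit `(p, 0, 1)` over `p ∈ Sⁿ`. -/
def unit (n : ℕ) (p : V n) : E n := (p, 0, 1)

/-- The fibre at `p` of the Lie algebroid `L(Z)`: the vectors tangent at the unit `(p, 0, 1)` to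
the left fibre through it. -/
def algebroidFiber (n : ℕ) (p : V n) : Set (E n) :=
  tangentConeAt ℝ (leftFiber n (unit n p)) (unit n p)

/-- The left invariant vector field on `Z` that extends a section `X` of `L(Z)` (a function on
units): its value at `z` is the image of `X (eR z)` under the tangent map of the left translation
by `z`, `w ↦ z w`, which is defined on the left fibre over `eR z`. -/
def leftInvariant (n : ℕ) (X : E n → E n) (z : E n) : E n :=
  fderivWithin ℝ (fun w => mul n z w) (leftFiber n (eR n z)) (eR n z) (X (eR n z))

/-- The bracket of sections of `L(Z)`: the restriction to the units of the commutator of the left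
invariant vector fields on `Z`. -/
def bracket (n : ℕ) (X Y : E n → E n) (p : V n) : E n :=
  VectorField.lieBracketWithin ℝ (leftInvariant n X) (leftInvariant n Y) (Z n) (unit n p)

/-- The anchor of `L(Z)` at `p`: the tangent map of the right projection at the unit `(p, 0, 1)`.
It takes values in the tangent space at `(p, 0, 1)` of the manifold `Sⁿ × {0} × {1}` of units. -/
def anchor (n : ℕ) (p : V n) (w : E n) : E n := fderivWithin ℝ (eR n) (Z n) (unit n p) w

/-- The orthogonal projection `P_p(w) = w - (w ⬝ p) p`. -/
def P (n : ℕ) (p w : V n) : V n := w - ⟪w, p⟫ • p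

/-- The isomorphism `(p, v, s) ↦ (p, v + s p)` from `TSⁿ ⊕ ℝ` to the trivial bundle
`Sⁿ × ℝⁿ⁺¹`, on the fibre at `p`; an element `(p, v, s)` of `TSⁿ ⊕ ℝ` is, as a tangent vector at
`(p, 0, 1)`, the velocity `(0, v, s)` of the curve `t ↦ (p, t v, 1 + t s)`. -/
def triv (n : ℕ) (p : V n) (w : E n) : V n := w.2.1 + w.2.2 • p

/-- The inverse isomorphism `(p, w) ↦ (p, P_p(w), w ⬝ p)`. -/
def trivInv (n : ℕ) (p w : V n) : E n := (0, P n p w, ⟪w, p⟫)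

/-- The basis sections `X_i(p, 0, 1) = (p, e_i - pⁱ p, pⁱ)` of `L(Z)`. -/
def X (n : ℕ) (i : Idx n) (ε : E n) : E n := (0, e n i - ε.1 i • ε.1, ε.1 i)

/-- The section of `L(Z)` that corresponds to the constant section `w` of `Sⁿ × ℝⁿ⁺¹`. -/
def constSection (n : ℕ) (w : V n) (ε : E n) : E n := trivInv n ε.1 w

end EuclideanLines

end

noncomputable section

namespace EuclideanLines

open Matrix

variable {n : ℕ}

/-! ### Matrix computations in `SO₀(1, n+1)` -/

/-! Everything reduces to refactoring g = b₁(s,y) as c b with c = (σ,η) in C and b in B. Since b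
fixes the timelike vector e₀, c e₀ = g e₀, and c e₀ determines c: the null functional "time plus
last coordinate" of c e₀ is σ, and its first n space coordinates are -η. The vector g e₀ depends
only on z = π(g) (`timePart`, `spacePart`), hence so do c and the last column `rightBase` of b =
c⁻¹g.

For u in ℝⁿ, compare c(0, b(u,0)) = g(0,(u,0)). The right side has some time component t and space
component b₁(u,0) - t p, so adding t p recovers b₁(u,0). This gives a linear map `transport`
depending only on z, with b(u,0) ↦ b₁(u,0). Together with (s₁,y₁)(s₂,y₂) = (s₁s₂, s₂y₁ + y₂) it
yields the explicit product in `mulRel_iff`: composability means that the base point of the second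
factor is `rightBase` of the first, and the product is affine in the second factor along a left
fibre.

Units, left fibres and left translations are then explicit. By `leftInvariant_constSection`, the
left invariant extension of a constant section equals on Z the field `invField`, which is smooth
near Z. Bracket and anchor at (p,0,1) only involve derivatives in directions tangent to the left
fibre, so they are computed along straight lines through the unit (`fderivWithin_unit_apply`). The
results are `bracket_constSection` and `anchor_trivInv`; the sections X_i are the constant sections
e_i in the trivialization. -/

lemma rot_mulVec (b : Matrix (Idx n) (Idx n) ℝ) (t : ℝ) (w : Idx n → ℝ) :
    rot n b *ᵥ Sum.elim (fun _ => t) w = Sum.elim (fun _ => t) (b *ᵥ w) := by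
  simp [rot, fromBlocks_mulVec, Function.comp_def]

/-- The time component of the image of `(t, w)` under `cMat n s y`. -/
def cTime (s : ℝ) (y : Fin n → ℝ) (t : ℝ) (w : Idx n → ℝ) : ℝ :=
  ((s ^ 2 + 1 + y ⬝ᵥ y) * t + (s ^ 2 - 1 + y ⬝ᵥ y) * w (Sum.inr ())) / (2 * s)
    - (y ⬝ᵥ fun i => w (Sum.inl i)) / s

/-- In this form the null functional t + w_{n+1} is visibly multiplied by s; the last coordinate is
recorded as that multiple minus the time component. -/
lemma cMat_mulVec {s : ℝ} (hs : s ≠ 0) (y : Fin n → ℝ) (t : ℝ) (w : Idx n → ℝ) :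
    cMat n s y *ᵥ Sum.elim (fun _ => t) w =
      Sum.elim (fun _ => cTime s y t w)
        (Sum.elim (fun i => w (Sum.inl i) - (t + w (Sum.inr ())) * y i)
          (fun _ => s * (t + w (Sum.inr ())) - cTime s y t w)) := by
  have key : ∀ c : ℝ, ∑ i, c * y i * w (Sum.inl i) = c * (y ⬝ᵥ fun i => w (Sum.inl i)) := by
    intro c
    simp [dotProduct, Finset.mul_sum, mul_assoc]
  ext i
  rcases i with i | i | i
  · simp only [mulVec, dotProduct, Fintype.sum_sum_type, cMat, fromBlocks_apply₁₁,
      fromBlocks_apply₁₂, of_apply, Sum.elim_inl, Sum.elim_inr, Finset.univ_unique,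
      Finset.sum_singleton, cTime]
    simp only [← dotProduct.eq_1, key]
    field_simp
    ring
  · simp [mulVec, dotProduct, Fintype.sum_sum_type, cMat, one_apply]
    ring
  · simp only [mulVec, dotProduct, Fintype.sum_sum_type, cMat, fromBlocks_apply₂₁,
      fromBlocks_apply₂₂, of_apply, Sum.elim_inl, Sum.elim_inr, Finset.univ_unique,
      Finset.sum_singleton, cTime]
    simp only [← dotProduct.eq_1, key]
    field_simp
    ring

lemma sumElim_eta (f : Unit ⊕ Idx n → ℝ) :
    f = Sum.elim (fun _ => f (Sum.inl ())) (fun i => f (Sum.inr i)) := by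
  ext i; rcases i with i | i <;> rfl

/-- Testing on vectors (t, w) turns matrix identities into vector identities, in which sums over the
first n coordinates stay packed as dot products. -/
lemma mat_ext {A A' : Mat n}
    (h : ∀ t w, A *ᵥ Sum.elim (fun _ => t) w = A' *ᵥ Sum.elim (fun _ => t) w) : A = A' := by
  apply Matrix.mulVec_injective
  ext1 f
  rw [sumElim_eta f]
  exact h _ _

lemma cMat_mul_cMat {s s' : ℝ} (hs : s ≠ 0) (hs' : s' ≠ 0) (y y' : Fin n → ℝ) :
    cMat n s y * cMat n s' y' = cMat n (s * s') (s' • y + y') := by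
  apply mat_ext
  intro t w
  rw [← mulVec_mulVec, cMat_mulVec hs', cMat_mulVec hs, cMat_mulVec (mul_ne_zero hs hs')]
  have h1 : cTime s y (cTime s' y' t w)
      (Sum.elim (fun i => w (Sum.inl i) - (t + w (Sum.inr ())) * y' i)
          (fun _ => s' * (t + w (Sum.inr ())) - cTime s' y' t w)) =
      cTime (s * s') (s' • y + y') t w := by
    have h2 : (fun i => w (Sum.inl i) - (t + w (Sum.inr ())) * y' i) =
      (fun i => w (Sum.inl i)) - (t + w (Sum.inr ())) • y' := rfl
    simp only [cTime, Sum.elim_inl, Sum.elim_inr]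
    rw [h2]
    simp only [dotProduct_sub, dotProduct_smul, add_dotProduct, dotProduct_add, smul_dotProduct,
      smul_eq_mul, dotProduct_comm y' y]
    field_simp
    ring
  rw [h1]
  congr 1
  ext i
  rcases i with i | i
  · simp; ring
  · simp; ring

lemma cMat_one : cMat n 1 0 = 1 := by
  apply mat_ext
  intro t w
  rw [cMat_mulVec one_ne_zero, one_mulVec]
  have h : cTime 1 (0 : Fin n → ℝ) t w = t := by simp [cTime]; ring
  rw [h]
  congr 1
  ext i
  rcases i with i | i <;> simp

lemma cMat_mul_inv {s : ℝ} (hs : s ≠ 0) (y : Fin n → ℝ) :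
    cMat n s y * cMat n s⁻¹ (-(s⁻¹ • y)) = 1 := by
  rw [cMat_mul_cMat hs (inv_ne_zero hs), mul_inv_cancel₀ hs, add_neg_cancel, cMat_one]

lemma cMat_inv_mul {s : ℝ} (hs : s ≠ 0) (y : Fin n → ℝ) :
    cMat n s⁻¹ (-(s⁻¹ • y)) * cMat n s y = 1 :=
  mul_eq_one_comm.mp (cMat_mul_inv hs y)

lemma cMat_lorentz {s : ℝ} (hs : s ≠ 0) (y : Fin n → ℝ) :
    (cMat n s y)ᵀ * minkowski n * cMat n s y = minkowski n := by
  have hJ : ∀ t (w : Idx n → ℝ), minkowski n *ᵥ Sum.elim (fun _ => t) w =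
      Sum.elim (fun _ => t) (-w) := by
    intro t w
    simp [minkowski, fromBlocks_mulVec, Function.comp_def, neg_mulVec]
  have hw : ∀ w : Idx n → ℝ, w = Sum.elim (fun i => w (Sum.inl i)) (fun _ => w (Sum.inr ())) := by
    intro w; ext i; rcases i with i | i <;> rfl
  apply mat_ext
  intro t w
  apply dotProduct_eq
  intro f
  rw [sumElim_eta f]
  generalize f (Sum.inl ()) = t'
  generalize (fun i => f (Sum.inr i)) = w'
  rw [dotProduct_comm, ← mulVec_mulVec, ← mulVec_mulVec, dotProduct_mulVec, vecMul_transpose,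
    cMat_mulVec hs, cMat_mulVec hs, hJ, hJ, dotProduct_comm _ (Sum.elim (fun _ => t') w')]
  have hel : ∀ (t t' : ℝ) (w w' : Idx n → ℝ),
    Sum.elim (fun _ : Unit => t) w ⬝ᵥ Sum.elim (fun _ => t') w' = t * t' + w ⬝ᵥ w' := by
    intros; simp [dotProduct]
  have hel' : ∀ (t t' : ℝ) (w w' : Fin n → ℝ),
    Sum.elim w (fun _ : Unit => t) ⬝ᵥ Sum.elim w' (fun _ => t') = w ⬝ᵥ w' + t * t' := by
    intros; simp [dotProduct]
  have hsub : ∀ (w : Idx n → ℝ) (c : ℝ), (fun i => w (Sum.inl i) - c * y i) =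
      (fun i => w (Sum.inl i)) - c • y := fun _ _ => rfl
  rw [hel, hel, dotProduct_neg, dotProduct_neg, hel', hw w, hw w', hel']
  simp only [hsub, Sum.elim_inl, Sum.elim_inr, cTime, dotProduct_sub, sub_dotProduct,
    dotProduct_smul, smul_dotProduct, smul_eq_mul, dotProduct_comm _ y]
  field_simp
  ring

lemma rot_transpose (b : Matrix (Idx n) (Idx n) ℝ) : (rot n b)ᵀ = rot n bᵀ := by
  simp [rot, fromBlocks_transpose]

lemma rot_injective : Function.Injective (rot n) := by
  intro b b' h
  exact (fromBlocks_inj.mp h).2.2.2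

lemma transpose_mul_self_of_mem {b : Matrix (Idx n) (Idx n) ℝ}
    (hb : b ∈ specialOrthogonalGroup (Idx n) ℝ) : bᵀ * b = 1 :=
  (mem_orthogonalGroup_iff' _ _).mp (mem_specialOrthogonalGroup_iff.mp hb).1

lemma rot_lorentz {b : Matrix (Idx n) (Idx n) ℝ} (hb : b ∈ specialOrthogonalGroup (Idx n) ℝ) :
    (rot n b)ᵀ * minkowski n * rot n b = minkowski n := by
  rw [rot_transpose]
  simp [rot, minkowski, fromBlocks_multiply, transpose_mul_self_of_mem hb]

lemma lorentz_mul {A A' : Mat n} (h : Aᵀ * minkowski n * A = minkowski n)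
    (h' : A'ᵀ * minkowski n * A' = minkowski n) :
    (A * A')ᵀ * minkowski n * (A * A') = minkowski n := by
  calc (A * A')ᵀ * minkowski n * (A * A') = A'ᵀ * (Aᵀ * minkowski n * A) * A' := by
        simp only [transpose_mul, Matrix.mul_assoc]
    _ = _ := by rw [h, h']

lemma det_rot (b : Matrix (Idx n) (Idx n) ℝ) : (rot n b).det = b.det := by
  simp [rot]

/-- Every element of C is a square in C, and the Lorentz condition forces the determinant of the
root to square to one. -/
lemma det_cMat {s : ℝ} (hs : 0 < s) (y : Fin n → ℝ) : (cMat n s y).det = 1 := by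
  have hr : 0 < √s := Real.sqrt_pos.mpr hs
  have h : cMat n s y = cMat n (√s) ((√s + 1)⁻¹ • y) * cMat n (√s) ((√s + 1)⁻¹ • y) := by
    rw [cMat_mul_cMat hr.ne' hr.ne', Real.mul_self_sqrt hs.le, smul_smul, ← add_smul]
    rw [show √s * (√s + 1)⁻¹ + (√s + 1)⁻¹ = 1 by field_simp, one_smul]
  have h2 := congrArg Matrix.det (cMat_lorentz hr.ne' ((√s + 1)⁻¹ • y))
  have h3 : (minkowski n).det ≠ 0 := by
    simp [minkowski, det_neg]
  rw [det_mul, det_mul, det_transpose] at h2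
  rw [h, det_mul]
  apply mul_right_cancel₀ h3
  linear_combination h2

lemma rot_mul_cMat_mem_G {b : Matrix (Idx n) (Idx n) ℝ}
    (hb : b ∈ specialOrthogonalGroup (Idx n) ℝ) {s : ℝ} (hs : 0 < s) (y : Fin n → ℝ) :
    rot n b * cMat n s y ∈ G n := by
  refine ⟨lorentz_mul (rot_lorentz hb) (cMat_lorentz hs.ne' y), ?_, ?_⟩
  · rw [det_mul, det_rot, det_cMat hs, (mem_specialOrthogonalGroup_iff.mp hb).2, mul_one]
  · have h : (rot n b * cMat n s y) (Sum.inl ()) (Sum.inl ()) =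
        (s ^ 2 + 1 + y ⬝ᵥ y) / (2 * s) := by
      simp [mul_apply, Fintype.sum_sum_type, rot, cMat]
    rw [h]
    have : 0 ≤ y ⬝ᵥ y := by
      simpa using dotProduct_star_self_nonneg y
    positivity

/-- Left multiplication by a rotation does not touch row 0, and row 0 of (s,y) determines s and y:
its first entry minus its last one is 1/s. Cancelling the C-factor then gives b. -/
lemma rot_mul_cMat_inj {b b' : Matrix (Idx n) (Idx n) ℝ} {s s' : ℝ} (hs : 0 < s) (hs' : 0 < s')
    {y y' : Fin n → ℝ} (h : rot n b * cMat n s y = rot n b' * cMat n s' y') :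
    b = b' ∧ s = s' ∧ y = y' := by
  have row : ∀ (b : Matrix (Idx n) (Idx n) ℝ) (s : ℝ) (y : Fin n → ℝ) j,
      (rot n b * cMat n s y) (Sum.inl ()) j = cMat n s y (Sum.inl ()) j := by
    intro b s y j
    simp [mul_apply, Fintype.sum_sum_type, rot]
  have e1 := congrFun (congrFun h (Sum.inl ())) (Sum.inl ())
  have e2 := congrFun (congrFun h (Sum.inl ())) (Sum.inr (Sum.inr ()))
  have e3 := fun i => congrFun (congrFun h (Sum.inl ())) (Sum.inr (Sum.inl i))
  simp only [row] at e1 e2 e3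
  simp only [cMat, fromBlocks_apply₁₁, fromBlocks_apply₁₂, of_apply, Sum.elim_inl,
    Sum.elim_inr] at e1 e2 e3
  have hss : s = s' := by
    have : 1 / s = 1 / s' := by
      have l1 : 1 / s = (s ^ 2 + 1 + y ⬝ᵥ y) / (2 * s) - (s ^ 2 - 1 + y ⬝ᵥ y) / (2 * s) := by
        field_simp; ring
      rw [l1, e1, e2]
      field_simp; ring
    simpa using this
  subst hss
  have hyy : y = y' := by
    ext i
    have := e3 i
    have h0 : -(1 / s) ≠ 0 := by simp [hs.ne']
    exact mul_left_cancel₀ h0 this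
  subst hyy
  refine ⟨?_, rfl, rfl⟩
  apply rot_injective
  have := congrArg (· * cMat n s⁻¹ (-(s⁻¹ • y))) h
  simpa only [Matrix.mul_assoc, cMat_mul_inv hs.ne', Matrix.mul_one] using this

/-- A proper Lorentz matrix that fixes the timelike basis vector is a rotation. -/
lemma exists_rot_eq {A : Mat n} (hA : Aᵀ * minkowski n * A = minkowski n) (hd : A.det = 1)
    (h0 : A *ᵥ Sum.elim (fun _ => 1) 0 = Sum.elim (fun _ => 1) 0) :
    ∃ b ∈ specialOrthogonalGroup (Idx n) ℝ, A = rot n b := by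
  obtain ⟨A₁, A₂, A₃, A₄, rfl⟩ : ∃ A₁ A₂ A₃ A₄, A = fromBlocks A₁ A₂ A₃ A₄ :=
    ⟨_, _, _, _, (fromBlocks_toBlocks A).symm⟩
  have h1 : A₁ = 1 := by
    ext i j
    have := congrFun h0 (Sum.inl ())
    simpa [fromBlocks_mulVec, mulVec, dotProduct, Function.comp_def] using this
  have h3 : A₃ = 0 := by
    ext i j
    have := congrFun h0 (Sum.inr i)
    simpa [fromBlocks_mulVec, mulVec, dotProduct, Function.comp_def] using this
  subst h1 h3
  simp only [minkowski, fromBlocks_transpose, fromBlocks_multiply, fromBlocks_inj] at hA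
  simp only [transpose_one, transpose_zero, Matrix.mul_zero, Matrix.zero_mul, Matrix.mul_one,
    Matrix.one_mul, add_zero, zero_add, Matrix.mul_neg, Matrix.neg_mul] at hA
  obtain ⟨-, h2, -, h4⟩ := hA
  -- Once the first column is e₀, the off-diagonal block of the Lorentz identity is A₂ itself, and
  -- the lower block says that A₄ is orthogonal.
  obtain rfl : A₂ = 0 := by simpa using h2
  have h4' : A₄ᵀ * A₄ = 1 := by simpa using h4
  refine ⟨A₄, mem_specialOrthogonalGroup_iff.mpr
    ⟨(mem_orthogonalGroup_iff' _ _).mpr h4', ?_⟩, rfl⟩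
  simpa using hd

/-- `SO(n+1)` acts transitively on `Sⁿ`. -/
lemma exists_rotation (hn : 0 < n) (p : V n) (hp : ‖p‖ = 1) :
    ∃ b ∈ specialOrthogonalGroup (Idx n) ℝ, (fun i => b i (Sum.inr ())) = p.ofLp := by
  classical
  have hv : Orthonormal ℝ (({Sum.inr ()} : Set (Idx n)).domRestrict fun _ => p) := by
    refine ⟨fun _ => hp, fun i j hij => (hij (Subsingleton.elim _ _)).elim⟩
  obtain ⟨f, hf⟩ := hv.exists_orthonormalBasis_extension_of_card_eq (by simp)
  have hfp : f (Sum.inr ()) = p := hf _ rfl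
  let b : Matrix (Idx n) (Idx n) ℝ := fun i j => f j i
  have hb : bᵀ * b = 1 := by
    ext i j
    have h := orthonormal_iff_ite.mp f.orthonormal i j
    rw [PiLp.inner_apply] at h
    rw [one_apply, ← h, mul_apply]
    exact Finset.sum_congr rfl fun k _ => mul_comm _ _
  have hcol : (fun i => b i (Sum.inr ())) = p.ofLp := by
    ext i; simp [b, hfp]
  have hdet : b.det * b.det = 1 := by
    have := congrArg Matrix.det hb
    simpa using this
  rcases mul_self_eq_one_iff.mp hdet with h | h
  · exact ⟨b, mem_specialOrthogonalGroup_iff.mpr ⟨(mem_orthogonalGroup_iff' _ _).mpr hb, h⟩, hcol⟩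
  -- If the determinant is -1, reverse one of the first n columns; the last column, which is p, is
  -- unchanged.
  · let d : Idx n → ℝ := fun i => if i = Sum.inl ⟨0, hn⟩ then -1 else 1
    have hd : diagonal d * diagonal d = 1 := by
      rw [diagonal_mul_diagonal, ← diagonal_one]
      congr 1; ext i; simp only [d]; split_ifs <;> simp
    refine ⟨b * diagonal d, mem_specialOrthogonalGroup_iff.mpr
      ⟨(mem_orthogonalGroup_iff' _ _).mpr ?_, ?_⟩, ?_⟩
    · change (b * diagonal d)ᵀ * _ = 1
      rw [transpose_mul, diagonal_transpose, Matrix.mul_assoc, ← Matrix.mul_assoc bᵀ, hb,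
        Matrix.one_mul, hd]
    · rw [det_mul, h, det_diagonal]
      simp [d, Finset.prod_ite_eq']
    · rw [← hcol]; ext i; simp [d, mul_diagonal]

/-! ### The structure maps of `Z` in coordinates -/

/-- The time component of `g e₀`, for `π(g) = z`. -/
def timePart (n : ℕ) (z : E n) : ℝ := (z.2.2 ^ 2 + 1 + ⟪z.2.1, z.2.1⟫) / (2 * z.2.2)

/-- The space component of `g e₀`, for `π(g) = z`. -/
def spacePart (n : ℕ) (z : E n) : V n :=
  ((z.2.2 ^ 2 - 1 - ⟪z.2.1, z.2.1⟫) / (2 * z.2.2)) • z.1 - z.2.1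

/-- The parameter `σ` of the factor `c = (σ, η)` in `g = c b`, for `π(g) = z`. -/
def scale (n : ℕ) (z : E n) : ℝ := timePart n z + spacePart n z (Sum.inr ())

/-- The base point of the right projection of `z`. -/
def rightBase (n : ℕ) (z : E n) : V n :=
  z.2.2⁻¹ • (z.1 + (z.2.2 - 1) • e n (Sum.inr ()) +
    ((1 - z.1 (Sum.inr ())) / scale n z) •
      (spacePart n z + (timePart n z - 1) • e n (Sum.inr ())))

/-- The linear part of the left translation by `z`, acting on the vectors orthogonal to
`rightBase n z`. -/
def transport (n : ℕ) (z : E n) (w : V n) : V n :=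
  w + w (Sum.inr ()) • (z.2.2 • z.1 - z.2.1 - e n (Sum.inr ())) +
    ((w (Sum.inr ()) * (1 + spacePart n z (Sum.inr ())) - ⟪spacePart n z, w⟫) / scale n z) •
      (e n (Sum.inr ()) - z.1)

@[simp] lemma e_last_inl (i : Fin n) : e n (Sum.inr ()) (Sum.inl i) = 0 := by simp [e]
@[simp] lemma e_last_inr (i : Unit) : e n (Sum.inr ()) (Sum.inr i) = 1 := by simp [e]

/-- The image g e₀ lies on the unit hyperboloid. -/
lemma timePart_sq {z : E n} (hz : z ∈ Z n) :
    timePart n z ^ 2 = 1 + ⟪spacePart n z, spacePart n z⟫ := by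
  obtain ⟨p, v, s⟩ := z
  obtain ⟨h1, h2, h3⟩ := hz
  simp only at h1 h2 h3
  have hpp : ⟪p, p⟫ = 1 := by rw [real_inner_self_eq_norm_sq, h1]; norm_num
  simp only [timePart, spacePart, inner_sub_left, inner_sub_right, real_inner_smul_left,
    real_inner_smul_right, real_inner_comm p v, h2, hpp]
  generalize ⟪v, v⟫ = m
  field_simp
  ring

lemma inner_eq_sum (v w : V n) :
    ⟪v, w⟫ = ((fun i => v (Sum.inl i)) ⬝ᵥ fun i => w (Sum.inl i)) +
      v (Sum.inr ()) * w (Sum.inr ()) := by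
  simp [PiLp.inner_apply, dotProduct, mul_comm]

/-- On the future sheet of the hyperboloid the time component exceeds the absolute value of each
space component. This makes the refactorization global and keeps the denominators nonzero on Z. -/
lemma scale_pos {z : E n} (hz : z ∈ Z n) : 0 < scale n z := by
  have h := timePart_sq hz
  rw [inner_eq_sum] at h
  have h0 : 0 < timePart n z := by
    have := hz.2.2
    have : 0 ≤ ⟪z.2.1, z.2.1⟫ := real_inner_self_nonneg
    rw [timePart]; positivity
  have h1 : 0 ≤ (fun i => spacePart n z (Sum.inl i)) ⬝ᵥ fun i => spacePart n z (Sum.inl i) := by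
    simpa using dotProduct_star_self_nonneg (fun i => spacePart n z (Sum.inl i))
  have h2 : |spacePart n z (Sum.inr ())| < timePart n z := by
    apply abs_lt_of_sq_lt_sq _ h0.le
    nlinarith
  rw [scale]
  linarith [(abs_lt.mp h2).1]

/-- The point `π(b (s, y))`. -/
def proj (b : Matrix (Idx n) (Idx n) ℝ) (s : ℝ) (y : Fin n → ℝ) : E n :=
  (WithLp.toLp 2 (fun i => b i (Sum.inr ())),
        WithLp.toLp 2 (b.mulVec (Sum.elim y (fun _ => 0))), s)

lemma mulVec_sumElim (b : Matrix (Idx n) (Idx n) ℝ) (y : Fin n → ℝ) (r : ℝ) :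
    b *ᵥ Sum.elim y (fun _ => r) =
      b *ᵥ Sum.elim y (fun _ => 0) + r • fun i => b i (Sum.inr ()) := by
  ext i
  simp [mulVec, dotProduct, mul_comm]

lemma inner_mulVec {b : Matrix (Idx n) (Idx n) ℝ} (hb : b ∈ specialOrthogonalGroup (Idx n) ℝ)
    (f g : Idx n → ℝ) :
    ⟪(WithLp.toLp 2 (b *ᵥ f) : V n), (WithLp.toLp 2 (b *ᵥ g) : V n)⟫ = f ⬝ᵥ g := by
  rw [EuclideanSpace.inner_toLp_toLp]
  simp only [star_trivial]
  rw [dotProduct_mulVec, ← mulVec_transpose, mulVec_mulVec, transpose_mul_self_of_mem hb,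
    one_mulVec, dotProduct_comm]

lemma col_eq_mulVec (b : Matrix (Idx n) (Idx n) ℝ) :
    (fun i => b i (Sum.inr ())) = b *ᵥ Sum.elim 0 (fun _ => 1) := by
  ext i; simp [mulVec, dotProduct]

lemma sumElim_dotProduct (t t' : ℝ) (w w' : Fin n → ℝ) :
    Sum.elim w (fun _ : Unit => t) ⬝ᵥ Sum.elim w' (fun _ => t') = w ⬝ᵥ w' + t * t' := by
  simp [dotProduct]

lemma proj_mem {b : Matrix (Idx n) (Idx n) ℝ} (hb : b ∈ specialOrthogonalGroup (Idx n) ℝ)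
    {s : ℝ} (hs : 0 < s) (y : Fin n → ℝ) : proj b s y ∈ Z n := by
  refine ⟨?_, ?_, hs⟩
  · rw [← sq_eq_sq₀ (norm_nonneg _) one_pos.le, ← real_inner_self_eq_norm_sq]
    simp only [proj, col_eq_mulVec, inner_mulVec hb, sumElim_dotProduct]
    simp
  · simp only [proj, col_eq_mulVec, inner_mulVec hb, sumElim_dotProduct]
    simp

lemma inner_proj_self {b : Matrix (Idx n) (Idx n) ℝ} (hb : b ∈ specialOrthogonalGroup (Idx n) ℝ)
    (s : ℝ) (y : Fin n → ℝ) : ⟪(proj b s y).2.1, (proj b s y).2.1⟫ = y ⬝ᵥ y := by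
  simp only [proj, inner_mulVec hb, sumElim_dotProduct]
  simp

lemma exists_eq_proj_of_col {b : Matrix (Idx n) (Idx n) ℝ}
    (hb : b ∈ specialOrthogonalGroup (Idx n) ℝ) {z : E n} (hz : z ∈ Z n)
    (hbp : (fun i => b i (Sum.inr ())) = z.1.ofLp) : ∃ y, z = proj b z.2.2 y := by
  obtain ⟨p, v, s⟩ := z
  obtain ⟨h1, h2, h3⟩ := hz
  simp only at h1 h2 h3 hbp
  have hbb : b * bᵀ = 1 := mul_eq_one_comm.mp (transpose_mul_self_of_mem hb)
  refine ⟨fun i => (bᵀ *ᵥ v.ofLp) (Sum.inl i), ?_⟩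
  -- The last coordinate of bᵀv is p ⬝ v, so v = b(y,0) with y the first n coordinates of bᵀv.
  have hlast : (bᵀ *ᵥ v.ofLp) (Sum.inr ()) = 0 := by
    rw [← h2]
    simp only [mulVec, dotProduct, transpose_apply, PiLp.inner_apply]
    apply Finset.sum_congr rfl
    intro i _
    rw [← congrFun hbp i]
    simp [mul_comm]
  have hy : Sum.elim (fun i => (bᵀ *ᵥ v.ofLp) (Sum.inl i)) (fun _ => 0) = bᵀ *ᵥ v.ofLp := by
    ext i
    rcases i with i | i
    · rfl
    · exact hlast.symm
  simp only [proj, hy, mulVec_mulVec, hbb, one_mulVec, hbp]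

lemma exists_eq_proj (hn : 0 < n) {z : E n} (hz : z ∈ Z n) :
    ∃ b ∈ specialOrthogonalGroup (Idx n) ℝ, ∃ y, z = proj b z.2.2 y := by
  obtain ⟨b, hb, hbp⟩ := exists_rotation hn z.1 hz.1
  exact ⟨b, hb, exists_eq_proj_of_col hb hz hbp⟩

/-- Writes the space part of g(t,u) through p, v and the single vector b(u',0), with u' the first n
coordinates of u. -/
lemma rot_cMat_mulVec_zero (b : Matrix (Idx n) (Idx n) ℝ) {s : ℝ} (hs : s ≠ 0) (y : Fin n → ℝ)
    {w : V n} (hw : w = WithLp.toLp 2 (b *ᵥ Sum.elim y fun _ => 0)) {p : V n}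
    (hp : p = WithLp.toLp 2 (fun i => b i (Sum.inr ()))) (t : ℝ) (u : Idx n → ℝ) :
    (rot n b * cMat n s y) *ᵥ Sum.elim (fun _ => t) u =
      Sum.elim (fun _ => cTime s y t u)
        ((s * (t + u (Sum.inr ())) - cTime s y t u) • p.ofLp - (t + u (Sum.inr ())) • w.ofLp +
          b *ᵥ Sum.elim (fun i => u (Sum.inl i)) fun _ => 0) := by
  subst hw hp
  rw [← mulVec_mulVec, cMat_mulVec hs, rot_mulVec]
  congr 1
  rw [mulVec_sumElim]
  have : (Sum.elim (fun i => u (Sum.inl i) - (t + u (Sum.inr ())) * y i) fun _ => 0 : Idx n → ℝ) =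
    (Sum.elim (fun i => u (Sum.inl i)) fun _ => 0) - (t + u (Sum.inr ())) •
      (Sum.elim y fun _ => 0) := by
    ext i
    rcases i with i | i <;> simp
  rw [this, mulVec_sub, mulVec_smul]
  abel

/-- The image of `e₀` under `cMat` with the parameters read off from `z`. -/
lemma cMat_scale_mulVec {z : E n} (hz : z ∈ Z n) :
    cMat n (scale n z) (fun i => - spacePart n z (Sum.inl i)) *ᵥ Sum.elim (fun _ => 1) 0 =
      Sum.elim (fun _ => timePart n z) (spacePart n z).ofLp := by
  have hpos := scale_pos hz
  rw [cMat_mulVec hpos.ne']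
  have h := timePart_sq hz
  have ht : cTime (scale n z) (fun i => - spacePart n z (Sum.inl i)) 1 0 = timePart n z := by
    rw [inner_eq_sum] at h
    have : ((fun i => -spacePart n z (Sum.inl i)) ⬝ᵥ fun i => -spacePart n z (Sum.inl i)) =
      (fun i => spacePart n z (Sum.inl i)) ⬝ᵥ fun i => spacePart n z (Sum.inl i) := by
      simp [dotProduct]
    simp only [cTime, this]
    have h0 : ((fun i => -spacePart n z (Sum.inl i)) ⬝ᵥ fun i => (0 : Idx n → ℝ) (Sum.inl i)) = 0 :=
      by simp [dotProduct]
    have h1 : ((fun i => spacePart n z (Sum.inl i)) ⬝ᵥ fun i => spacePart n z (Sum.inl i)) =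
        timePart n z ^ 2 - 1 - spacePart n z (Sum.inr ()) * spacePart n z (Sum.inr ()) := by
      linarith
    rw [h0, h1]
    field_simp
    simp only [scale, Pi.zero_apply]
    ring
  rw [ht]
  congr 1
  ext i
  rcases i with i | i
  · simp
  · simp [scale]

/-- The image of `e₀` under `b (s, y)`. -/
lemma rot_mul_cMat_mulVec_one {b : Matrix (Idx n) (Idx n) ℝ}
    (hb : b ∈ specialOrthogonalGroup (Idx n) ℝ) {s : ℝ} (hs : 0 < s) (y : Fin n → ℝ) :
    (rot n b * cMat n s y) *ᵥ Sum.elim (fun _ => 1) 0 =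
      Sum.elim (fun _ => timePart n (proj b s y)) (spacePart n (proj b s y)).ofLp := by
  have ht : cTime s y 1 0 = timePart n (proj b s y) := by
    rw [timePart, inner_proj_self hb]
    simp [cTime, proj, dotProduct]
  have h00 : (Sum.elim (fun i => (0 : Idx n → ℝ) (Sum.inl i)) fun _ => 0 : Idx n → ℝ) = 0 := by
    ext i; rcases i with i | i <;> rfl
  rw [rot_cMat_mulVec_zero b hs.ne' y (w := (proj b s y).2.1) rfl (p := (proj b s y).1) rfl,
    h00, mulVec_zero, ht]
  congr 1
  simp only [spacePart, timePart, Pi.zero_apply, add_zero, mul_one, one_smul,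
    WithLp.ofLp_sub, WithLp.ofLp_smul]
  congr 2
  simp only [proj]
  field_simp
  ring

/-- The parameters of the factor `c₁` in `b₁ (s, y) = c₁ b`. -/
lemma eq_scale_of_cMat_mul_rot {b b₁ : Matrix (Idx n) (Idx n) ℝ}
    (hb₁ : b₁ ∈ specialOrthogonalGroup (Idx n) ℝ) {s σ : ℝ} (hs : 0 < s) (hσ : 0 < σ)
    {y η : Fin n → ℝ} (h : cMat n σ η * rot n b = rot n b₁ * cMat n s y) :
    σ = scale n (proj b₁ s y) ∧ η = fun i => - spacePart n (proj b₁ s y) (Sum.inl i) := by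
  have h0 := congrArg (· *ᵥ Sum.elim (fun _ => 1) 0) h
  beta_reduce at h0
  rw [← mulVec_mulVec, rot_mulVec, mulVec_zero, cMat_mulVec hσ.ne',
    rot_mul_cMat_mulVec_one hb₁ hs] at h0
  have e1 := congrFun h0 (Sum.inl ())
  have e2 := congrFun h0 (Sum.inr (Sum.inr ()))
  have e3 := fun i => congrFun h0 (Sum.inr (Sum.inl i))
  simp only [Sum.elim_inl, Sum.elim_inr, Pi.zero_apply, add_zero, mul_one, one_mul] at e1 e2 e3
  refine ⟨?_, ?_⟩
  · rw [scale, ← e1, ← e2]; ring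
  · ext i; rw [← e3 i]; simp

/-- The decomposition `b₁ (s, y) = c₁ b`. -/
lemma exists_cMat_mul_rot {b₁ : Matrix (Idx n) (Idx n) ℝ}
    (hb₁ : b₁ ∈ specialOrthogonalGroup (Idx n) ℝ) {s : ℝ} (hs : 0 < s) (y : Fin n → ℝ) :
    ∃ b ∈ specialOrthogonalGroup (Idx n) ℝ, ∃ (σ : ℝ) (η : Fin n → ℝ), 0 < σ ∧
      cMat n σ η * rot n b = rot n b₁ * cMat n s y := by
  have hz := proj_mem hb₁ hs y
  have hpos := scale_pos hz
  set σ := scale n (proj b₁ s y)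
  set η : Fin n → ℝ := fun i => - spacePart n (proj b₁ s y) (Sum.inl i) with hη
  -- With c = (σ,η) chosen so that c e₀ = g e₀, the matrix c⁻¹g fixes e₀ and is therefore a
  -- rotation.
  obtain ⟨b, hb, hbeq⟩ := exists_rot_eq (A := cMat n σ⁻¹ (-(σ⁻¹ • η)) * (rot n b₁ * cMat n s y))
    (lorentz_mul (cMat_lorentz (inv_ne_zero hpos.ne') _)
      (lorentz_mul (rot_lorentz hb₁) (cMat_lorentz hs.ne' y)))
    (by rw [det_mul, det_mul, det_rot, det_cMat hs, det_cMat (inv_pos.mpr hpos),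
      (mem_specialOrthogonalGroup_iff.mp hb₁).2, one_mul, one_mul])
    (by rw [← mulVec_mulVec, rot_mul_cMat_mulVec_one hb₁ hs, ← cMat_scale_mulVec hz,
      mulVec_mulVec, cMat_inv_mul hpos.ne', one_mulVec])
  refine ⟨b, hb, σ, η, hpos, ?_⟩
  rw [← hbeq, ← Matrix.mul_assoc, cMat_mul_inv hpos.ne', Matrix.one_mul]

/-- The action of `c₁` on space vectors, where `b₁ (s, y) = c₁ b`. -/
lemma transport_eq {z : E n} (hz : z ∈ Z n) (w : V n) {t : ℝ} {u : V n}
    (h : cMat n (scale n z) (fun i => - spacePart n z (Sum.inl i)) *ᵥ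
      Sum.elim (fun _ => 0) w.ofLp = Sum.elim (fun _ => t) u.ofLp) :
    transport n z w = u + t • z.1 ∧ u = w + w (Sum.inr ()) • spacePart n z +
      (scale n z * w (Sum.inr ()) - t - w (Sum.inr ()) * (1 + spacePart n z (Sum.inr ()))) •
        e n (Sum.inr ()) ∧
      scale n z * w (Sum.inr ()) = t + u (Sum.inr ()) := by
  have hpos := scale_pos hz
  have hs := hz.2.2
  rw [cMat_mulVec hpos.ne'] at h
  have e1 := congrFun h (Sum.inl ())
  have e2 := congrFun h (Sum.inr (Sum.inr ()))
  have e3 := fun i => congrFun h (Sum.inr (Sum.inl i))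
  simp only [Sum.elim_inl, Sum.elim_inr, zero_add] at e1 e2 e3
  rw [e1] at e2
  have hu : u = w + w (Sum.inr ()) • spacePart n z +
      (scale n z * w (Sum.inr ()) - t - w (Sum.inr ()) * (1 + spacePart n z (Sum.inr ()))) •
        e n (Sum.inr ()) := by
    ext i
    rcases i with i | i
    · simp [← e3 i]
    · simp [← e2]; ring
  refine ⟨?_, hu, by linarith⟩
  have hsq := timePart_sq hz
  have hx : z.2.2 • z.1 - z.2.1 = spacePart n z + timePart n z • z.1 := by
    rw [spacePart, timePart, sub_add_eq_add_sub, ← add_smul]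
    congr 2
    field_simp
    ring
  have ht : t = timePart n z * w (Sum.inr ()) -
      (w (Sum.inr ()) * (1 + spacePart n z (Sum.inr ())) - ⟪spacePart n z, w⟫) / scale n z := by
    rw [← e1]
    rw [inner_eq_sum] at hsq ⊢
    -- The hyperboloid identity eliminates |η|², so that only `scale` remains as a denominator.
    have h1 : ((fun i => -spacePart n z (Sum.inl i)) ⬝ᵥ fun i => -spacePart n z (Sum.inl i)) =
        timePart n z ^ 2 - 1 - spacePart n z (Sum.inr ()) * spacePart n z (Sum.inr ()) := by
      rw [hsq]; simp [dotProduct]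
    have h2 : ((fun i => -spacePart n z (Sum.inl i)) ⬝ᵥ fun i => w (Sum.inl i)) =
        -((fun i => spacePart n z (Sum.inl i)) ⬝ᵥ fun i => w (Sum.inl i)) := by
      simp [dotProduct]
    simp only [cTime, h1, h2]
    generalize ((fun i => spacePart n z (Sum.inl i)) ⬝ᵥ fun i => w (Sum.inl i)) = d
    field_simp
    simp only [scale]
    ring
  rw [transport, hx, hu]
  have : (w (Sum.inr ()) * (1 + spacePart n z (Sum.inr ())) - ⟪spacePart n z, w⟫) / scale n z =
    timePart n z * w (Sum.inr ()) - t := by rw [ht]; ring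
  rw [this]
  simp only [scale]
  module

/-- All three relations come from applying c b = b₁(s,y) to space vectors (0,u): u = e_{n+1} gives
the first two, u = (y',0) the third. The right-hand sides show that the last column of b depends on
z alone. -/
lemma relations_of_cMat_mul_rot {b b₁ : Matrix (Idx n) (Idx n) ℝ}
    (hb₁ : b₁ ∈ specialOrthogonalGroup (Idx n) ℝ) {s σ : ℝ} (hs : 0 < s) (hσ : 0 < σ)
    {y η : Fin n → ℝ} (h : cMat n σ η * rot n b = rot n b₁ * cMat n s y) :
    WithLp.toLp 2 (fun i => b i (Sum.inr ())) = rightBase n (proj b₁ s y) ∧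
    (transport n (proj b₁ s y) (rightBase n (proj b₁ s y)) = s • (proj b₁ s y).1 -
      (proj b₁ s y).2.1) ∧
    ∀ y' : Fin n → ℝ, transport n (proj b₁ s y)
      (WithLp.toLp 2 (b *ᵥ Sum.elim y' fun _ => 0)) =
        WithLp.toLp 2 (b₁ *ᵥ Sum.elim y' fun _ => 0) := by
  have hz := proj_mem hb₁ hs y
  obtain ⟨h1, h2⟩ := eq_scale_of_cMat_mul_rot hb₁ hs hσ h
  have hpos := scale_pos hz
  subst h2
  rw [h1] at h
  have key : ∀ u : Idx n → ℝ, cMat n (scale n (proj b₁ s y)) (fun i => - spacePart n (proj b₁ s y)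
      (Sum.inl i)) *ᵥ Sum.elim (fun _ => 0) (WithLp.toLp 2 (b *ᵥ u) : V n).ofLp =
      Sum.elim (fun _ => cTime s y 0 u)
        ((s * u (Sum.inr ()) - cTime s y 0 u) • (proj b₁ s y).1 -
          u (Sum.inr ()) • (proj b₁ s y).2.1 +
          WithLp.toLp 2 (b₁ *ᵥ Sum.elim (fun i => u (Sum.inl i)) fun _ => 0)).ofLp := by
    intro u
    have := congrArg (· *ᵥ Sum.elim (fun _ => 0) u) h
    simp only at this
    rw [← mulVec_mulVec, rot_mulVec, rot_cMat_mulVec_zero b₁ hs.ne' y rfl rfl] at this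
    simpa [proj] using this
  have k1 := transport_eq hz _ (key (Sum.elim 0 fun _ => 1))
  have hc : cTime s y 0 (Sum.elim 0 fun _ => 1) = (s ^ 2 - 1 + y ⬝ᵥ y) / (2 * s) := by
    simp [cTime, dotProduct]
  have h00 : (Sum.elim (fun i => (Sum.elim 0 fun _ => 1 : Idx n → ℝ) (Sum.inl i)) fun _ => 0 :
      Idx n → ℝ) = 0 := by
    ext i; rcases i with i | i <;> rfl
  rw [h00, mulVec_zero, hc, ← col_eq_mulVec] at k1
  obtain ⟨k1, k2, k3⟩ := k1
  have hvv := inner_proj_self hb₁ s y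
  have hq : WithLp.toLp 2 (fun i => b i (Sum.inr ())) = rightBase n (proj b₁ s y) := by
    set q : V n := WithLp.toLp 2 (fun i => b i (Sum.inr ())) with hqdef
    set z := proj b₁ s y with hzdef
    have hzs : z.2.2 = s := rfl
    have hx : z.2.1 = ((s ^ 2 - 1 - y ⬝ᵥ y) / (2 * s)) • z.1 - spacePart n z := by
      rw [spacePart, hvv, hzs]; abel
    have hT : timePart n z = (s ^ 2 + 1 + y ⬝ᵥ y) / (2 * s) := by
      rw [timePart, hvv, hzs]
    -- Since c multiplies the null functional by σ, `k3` determines the last coordinate of q; `k2`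
    -- is then solved for q itself.
    have hqN : q (Sum.inr ()) = 1 - (1 - z.1 (Sum.inr ())) / (s * scale n z) := by
      rw [hx] at k3
      simp at k3
      have k4 : s * (scale n z * q (Sum.inr ())) = s * scale n z - (1 - z.1 (Sum.inr ())) := by
        rw [k3, scale, hT]
        field_simp
        ring
      field_simp
      linear_combination k4
    have hxN : spacePart n z (Sum.inr ()) = scale n z - timePart n z := by rw [scale]; ring
    rw [hxN] at k2
    have hk2 := eq_sub_of_add_eq (eq_sub_of_add_eq k2.symm)
    rw [hk2, hx, hqN, rightBase, hzs, hT]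
    simp only [Sum.elim_inr, WithLp.toLp_zero]
    match_scalars <;> field_simp <;> ring
  refine ⟨hq, ?_, ?_⟩
  · rw [← hq, k1]
    simp only [Sum.elim_inr, WithLp.toLp_zero, add_zero, one_smul]
    match_scalars
    · field_simp; ring
    · ring
  · intro y'
    have k := (transport_eq hz _ (key (Sum.elim y' fun _ => 0))).1
    rw [k]
    simp

/-! ### The groupoid `Z` -/

lemma transport_add (z : E n) (w w' : V n) :
    transport n z (w + w') = transport n z w + transport n z w' := by
  simp only [transport, PiLp.add_apply, inner_add_right]
  module

lemma transport_smul (z : E n) (c : ℝ) (w : V n) :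
    transport n z (c • w) = c • transport n z w := by
  simp only [transport, PiLp.smul_apply, real_inner_smul_right, smul_eq_mul]
  module

/-- Forward, uniqueness of the factorization b c identifies the lift of z₂ with the middle rotation
b. Backward, any lift b₁ of z₁ produces b, and z₂ can be lifted with this same b exactly because its
base point is the last column of b. -/
theorem mulRel_iff (hn : 0 < n) (z₃ z₁ z₂ : E n) :
    MulRel n z₃ z₁ z₂ ↔ z₁ ∈ Z n ∧ z₂ ∈ Z n ∧ z₂.1 = rightBase n z₁ ∧
      z₃ = (z₁.1, z₂.2.2 • z₁.2.1 + transport n z₁ z₂.2.1, z₁.2.2 * z₂.2.2) := by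
  have hproj : ∀ (b₁ : Matrix (Idx n) (Idx n) ℝ) (s₁ s₂ : ℝ) (y₁ y₂ : Fin n → ℝ),
      proj b₁ (s₁ * s₂) (s₂ • y₁ + y₂) = ((proj b₁ s₁ y₁).1, s₂ • (proj b₁ s₁ y₁).2.1 +
        WithLp.toLp 2 (b₁ *ᵥ Sum.elim y₂ fun _ => 0), s₁ * s₂) := by
    intro b₁ s₁ s₂ y₁ y₂
    have : (Sum.elim (s₂ • y₁ + y₂) fun _ => 0 : Idx n → ℝ) =
        s₂ • (Sum.elim y₁ fun _ => 0) + Sum.elim y₂ fun _ => 0 := by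
      ext i; rcases i with i | i <;> simp
    simp only [proj, this, mulVec_add, mulVec_smul]
    rfl
  constructor
  · rintro ⟨g₃, g₁, g₂, ⟨-, b₃, hb₃, s₃, y₃, hs₃, rfl, hz₃⟩, ⟨-, b₁, hb₁, s₁, y₁, hs₁, hg₁, hz₁⟩,
      ⟨-, b₂, hb₂, s₂, y₂, hs₂, hg₂, hz₂⟩, -, -, _, ⟨σ, η, hσ, rfl⟩, _, ⟨b, hb, rfl⟩, _,
      ⟨σ₂, η₂, hσ₂, rfl⟩, h₁, h₂, h₃⟩
    change z₃ = proj b₃ s₃ y₃ at hz₃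
    change z₁ = proj b₁ s₁ y₁ at hz₁
    change z₂ = proj b₂ s₂ y₂ at hz₂
    obtain ⟨rfl, rfl, rfl⟩ := rot_mul_cMat_inj hs₂ hσ₂ (hg₂.symm.trans h₂)
    have h₁' := h₁.symm.trans hg₁
    rw [h₁', Matrix.mul_assoc, cMat_mul_cMat hs₁.ne' hs₂.ne'] at h₃
    obtain ⟨rfl, rfl, rfl⟩ := rot_mul_cMat_inj hs₃ (mul_pos hs₁ hs₂) h₃
    obtain ⟨r₁, -, r₃⟩ := relations_of_cMat_mul_rot hb₁ hs₁ hσ h₁'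
    subst hz₁ hz₂ hz₃
    refine ⟨proj_mem hb₁ hs₁ y₁, proj_mem hb hs₂ y₂, r₁, ?_⟩
    rw [hproj, ← r₃]
    rfl
  · rintro ⟨hz₁, hz₂, hq, rfl⟩
    obtain ⟨b₁, hb₁, y₁, hy₁⟩ := exists_eq_proj hn hz₁
    have hs₁ : 0 < z₁.2.2 := hz₁.2.2
    have hs₂ : 0 < z₂.2.2 := hz₂.2.2
    obtain ⟨b, hb, σ, η, hσ, h⟩ := exists_cMat_mul_rot hb₁ hs₁ y₁
    obtain ⟨r₁, -, r₃⟩ := relations_of_cMat_mul_rot hb₁ hs₁ hσ h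
    rw [← hy₁] at r₁ r₃
    obtain ⟨y₂, hy₂⟩ := exists_eq_proj_of_col hb hz₂ (by rw [hq, ← r₁])
    have e₃ : cMat n σ η * rot n b * cMat n z₂.2.2 y₂ =
        rot n b₁ * cMat n (z₁.2.2 * z₂.2.2) (z₂.2.2 • y₁ + y₂) := by
      rw [h, Matrix.mul_assoc, cMat_mul_cMat hs₁.ne' hs₂.ne']
    refine ⟨cMat n σ η * rot n b * cMat n z₂.2.2 y₂, cMat n σ η * rot n b,
      rot n b * cMat n z₂.2.2 y₂, ⟨?_, b₁, hb₁, _, _, mul_pos hs₁ hs₂, e₃, ?_⟩,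
      ⟨?_, b₁, hb₁, _, _, hs₁, h, hy₁⟩, ⟨?_, b, hb, _, _, hs₂, rfl, hy₂⟩, ?_, ?_,
      _, ⟨σ, η, hσ, rfl⟩, _, ⟨b, hb, rfl⟩, _, ⟨_, _, hs₂, rfl⟩, rfl, rfl, rfl⟩
    · rw [e₃]; exact rot_mul_cMat_mem_G hb₁ (mul_pos hs₁ hs₂) _
    · change _ = proj b₁ (z₁.2.2 * z₂.2.2) (z₂.2.2 • y₁ + y₂)
      rw [hproj, ← hy₁, ← r₃]
      congr 3
      nth_rewrite 1 [hy₂]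
      rfl
    · rw [h]; exact rot_mul_cMat_mem_G hb₁ hs₁ _
    · exact rot_mul_cMat_mem_G hb hs₂ _
    · rw [h]; exact rot_mul_cMat_mem_G hb₁ hs₁ _
    · exact rot_mul_cMat_mem_G hb hs₂ _

/-- The second identity extends the description of `transport` from the complement of `rightBase` to
the whole space; it is what removes the projection P from left invariant fields. -/
lemma rightBase_properties (hn : 0 < n) {z : E n} (hz : z ∈ Z n) :
    ‖rightBase n z‖ = 1 ∧ transport n z (rightBase n z) = z.2.2 • z.1 - z.2.1 := by
  obtain ⟨b₁, hb₁, y₁, hy₁⟩ := exists_eq_proj hn hz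
  have hs₁ : 0 < z.2.2 := hz.2.2
  obtain ⟨b, hb, σ, η, hσ, h⟩ := exists_cMat_mul_rot hb₁ hs₁ y₁
  obtain ⟨r₁, r₂, -⟩ := relations_of_cMat_mul_rot hb₁ hs₁ hσ h
  rw [← hy₁] at r₁ r₂
  refine ⟨?_, r₂⟩
  rw [← r₁]
  exact (proj_mem hb one_pos 0).1

lemma mem_units_iff (hn : 0 < n) (z : E n) : z ∈ units n ↔ ∃ p, ‖p‖ = 1 ∧ z = unit n p := by
  constructor
  · rintro ⟨_, ⟨b', hb', rfl⟩, -, b, hb, s, y, hs, h, hz⟩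
    have h' : rot n b' * cMat n 1 0 = rot n b * cMat n s y := by
      rw [cMat_one, Matrix.mul_one, h]
    obtain ⟨rfl, rfl, rfl⟩ := rot_mul_cMat_inj one_pos hs h'
    refine ⟨_, (proj_mem hb one_pos 0).1, ?_⟩
    rw [hz]
    have : (Sum.elim 0 fun _ => 0 : Idx n → ℝ) = 0 := by
      ext i; rcases i with i | i <;> rfl
    simp [unit, proj, this]
  · rintro ⟨p, hp, rfl⟩
    obtain ⟨b, hb, hbp⟩ := exists_rotation hn p hp
    have h' : rot n b = rot n b * cMat n 1 0 := by
      rw [cMat_one, Matrix.mul_one]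
    refine ⟨rot n b, ⟨b, hb, rfl⟩, ?_, b, hb, 1, 0, one_pos, h', ?_⟩
    · rw [h']; exact rot_mul_cMat_mem_G hb one_pos 0
    · have : (Sum.elim 0 fun _ => 0 : Idx n → ℝ) = 0 := by
        ext i; rcases i with i | i <;> rfl
      simp [unit, hbp, this]

@[simp] lemma timePart_unit (p : V n) : timePart n (unit n p) = 1 := by simp [timePart, unit]

@[simp] lemma spacePart_unit (p : V n) : spacePart n (unit n p) = 0 := by simp [spacePart, unit]

@[simp] lemma scale_unit (p : V n) : scale n (unit n p) = 1 := by simp [scale]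

@[simp] lemma rightBase_unit (p : V n) : rightBase n (unit n p) = p := by
  simp [rightBase]; simp [unit]

@[simp] lemma transport_unit (p w : V n) : transport n (unit n p) w = w := by
  simp [transport]
  simp [unit]
  module

lemma unit_mem {p : V n} (hp : ‖p‖ = 1) : unit n p ∈ Z n :=
  ⟨hp, by simp [unit], by simp [unit]⟩

lemma transport_zero (z : E n) : transport n z 0 = 0 := by simp [transport]

lemma isUnit_left_iff (hn : 0 < n) {z : E n} (hz : z ∈ Z n) (ε : E n) :
    (ε ∈ units n ∧ MulRel n z ε z) ↔ ε = unit n z.1 := by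
  rw [mem_units_iff hn, mulRel_iff hn]
  constructor
  · rintro ⟨⟨p, hp, rfl⟩, -, -, h, -⟩
    rw [h, rightBase_unit]
  · rintro rfl
    refine ⟨⟨_, hz.1, rfl⟩, unit_mem hz.1, hz, (rightBase_unit _).symm, ?_⟩
    rw [transport_unit]
    simp [unit]

lemma isUnit_right_iff (hn : 0 < n) {z : E n} (hz : z ∈ Z n) (ε : E n) :
    (ε ∈ units n ∧ MulRel n z z ε) ↔ ε = unit n (rightBase n z) := by
  rw [mem_units_iff hn, mulRel_iff hn]
  constructor
  · rintro ⟨⟨p, hp, rfl⟩, -, -, h, -⟩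
    rw [← h]; rfl
  · rintro rfl
    have h := (rightBase_properties hn hz).1
    refine ⟨⟨_, h, rfl⟩, hz, unit_mem h, rfl, ?_⟩
    simp [unit, transport_zero]

lemma eL_eq (hn : 0 < n) {z : E n} (hz : z ∈ Z n) : eL n z = unit n z.1 :=
  (isUnit_left_iff hn hz _).mp (Classical.epsilon_spec
    (p := fun ε => ε ∈ units n ∧ MulRel n z ε z) ⟨_, (isUnit_left_iff hn hz _).mpr rfl⟩)

lemma eR_eq (hn : 0 < n) {z : E n} (hz : z ∈ Z n) : eR n z = unit n (rightBase n z) :=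
  (isUnit_right_iff hn hz _).mp (Classical.epsilon_spec
    (p := fun ε => ε ∈ units n ∧ MulRel n z z ε) ⟨_, (isUnit_right_iff hn hz _).mpr rfl⟩)

lemma unit_injective : Function.Injective (unit n) := fun _ _ h => congrArg Prod.fst h

lemma mulRel_iff_of_mem (hn : 0 < n) {z w : E n} (hz : z ∈ Z n) (hw : w ∈ Z n)
    (h : w.1 = rightBase n z) (z₃ : E n) :
    MulRel n z₃ z w ↔ z₃ = (z.1, w.2.2 • z.2.1 + transport n z w.2.1, z.2.2 * w.2.2) := by
  rw [mulRel_iff hn]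
  exact ⟨fun h => h.2.2.2, fun h' => ⟨hz, hw, h, h'⟩⟩

lemma mul_eq (hn : 0 < n) {z w : E n} (hz : z ∈ Z n) (hw : w ∈ Z n)
    (h : w.1 = rightBase n z) :
    mul n z w = (z.1, w.2.2 • z.2.1 + transport n z w.2.1, z.2.2 * w.2.2) :=
  (mulRel_iff_of_mem hn hz hw h _).mp (Classical.epsilon_spec
    (p := fun z₃ => MulRel n z₃ z w) ⟨_, (mulRel_iff_of_mem hn hz hw h _).mpr rfl⟩)

lemma mem_leftFiber_iff (hn : 0 < n) (p : V n) (z : E n) :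
    z ∈ leftFiber n (unit n p) ↔ z ∈ Z n ∧ z.1 = p := by
  refine and_congr_right fun hz => ?_
  rw [eL_eq hn hz, unit_injective.eq_iff]

/-! ### The Lie algebroid of `Z` -/

lemma algebroidFiber_eq (hn : 0 < n) {p : V n} (hp : ‖p‖ = 1) :
    algebroidFiber n p = {w | w.1 = 0 ∧ ⟪p, w.2.1⟫ = 0} := by
  -- The condition s > 0 is open, so near the unit the left fibre is an affine subspace.
  have hU : {z : E n | 0 < z.2.2} ∈ nhds (unit n p) :=
    (isOpen_lt continuous_const (by fun_prop)).mem_nhds (by simp [unit])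
  have hset : leftFiber n (unit n p) =
      {z : E n | z.1 = p ∧ ⟪p, z.2.1⟫ = 0} ∩ {z : E n | 0 < z.2.2} := by
    ext z
    rw [mem_leftFiber_iff hn]
    constructor
    · rintro ⟨⟨-, h2, h3⟩, rfl⟩
      exact ⟨⟨rfl, h2⟩, h3⟩
    · rintro ⟨⟨rfl, h2⟩, h3⟩
      exact ⟨⟨hp, h2, h3⟩, rfl⟩
  rw [algebroidFiber, hset, tangentConeAt_inter_nhds hU]
  ext w
  constructor
  · intro hw
    let T : E n →L[ℝ] V n × ℝ := (ContinuousLinearMap.fst ℝ _ _).prod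
      ((innerSL ℝ p).comp ((ContinuousLinearMap.fst ℝ _ _).comp (ContinuousLinearMap.snd ℝ _ _)))
    have h1 : HasFDerivWithinAt T T {z : E n | z.1 = p ∧ ⟪p, z.2.1⟫ = 0} (unit n p) :=
      T.hasFDerivAt.hasFDerivWithinAt
    -- T collects the equations of the affine subspace and is constant there, so T and 0 are both
    -- derivatives within it and agree on tangent vectors.
    have h2 : HasFDerivWithinAt T (0 : E n →L[ℝ] V n × ℝ)
        {z : E n | z.1 = p ∧ ⟪p, z.2.1⟫ = 0} (unit n p) := by
      refine (hasFDerivWithinAt_const ((p, 0) : V n × ℝ) _ _).congr ?_ ?_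
      · rintro z ⟨rfl, hz⟩
        simp [T, hz]
      · simp [T, unit]
    have := h1.unique_on h2 hw
    simpa [T, Prod.ext_iff] using this
  · rintro ⟨h1, h2⟩
    have : unit n p + w - unit n p ∈
        tangentConeAt ℝ {z : E n | z.1 = p ∧ ⟪p, z.2.1⟫ = 0} (unit n p) := by
      apply mem_tangentConeAt_of_segment_subset
      rw [segment_eq_image']
      rintro _ ⟨t, -, rfl⟩
      simp [unit, h1, h2, real_inner_smul_right]
    simpa using this

lemma mem_algebroidFiber_trivInv (hn : 0 < n) {p : V n} (hp : ‖p‖ = 1) (w : V n) :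
    trivInv n p w ∈ algebroidFiber n p := by
  rw [algebroidFiber_eq hn hp]
  refine ⟨rfl, ?_⟩
  simp [trivInv, P, inner_sub_right, real_inner_smul_right, hp, real_inner_comm]

lemma algebroidFiber_subset (p : V n) :
    algebroidFiber n p ⊆ tangentConeAt ℝ (Z n) (unit n p) :=
  tangentConeAt_mono fun _ h => h.1

/-- Sets with empty interior do not determine a derivative within them on all vectors; on tangent
vectors any two choices coincide. -/
lemma fderivWithin_apply_of_mem_tangentConeAt {F F' : Type*} [NormedAddCommGroup F]
    [NormedSpace ℝ F] [NormedAddCommGroup F'] [NormedSpace ℝ F'] {f : F → F'} {f' : F →L[ℝ] F'}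
    {S : Set F} {x v : F} (hf : HasFDerivWithinAt f f' S x) (hv : v ∈ tangentConeAt ℝ S x) :
    fderivWithin ℝ f S x v = f' v :=
  hf.differentiableWithinAt.hasFDerivWithinAt.unique_on hf hv

/-- The left invariant extension of the constant section `w`, as a function on `E n`. -/
def invField (n : ℕ) (w : V n) (z : E n) : E n :=
  (0, transport n z w + ⟪w, rightBase n z⟫ • ((2 : ℝ) • z.2.1 - z.2.2 • z.1),
    z.2.2 * ⟪w, rightBase n z⟫)

lemma leftInvariant_constSection (hn : 0 < n) (w : V n) {z : E n} (hz : z ∈ Z n) :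
    leftInvariant n (constSection n w) z = invField n w z := by
  obtain ⟨hq, hT⟩ := rightBase_properties hn hz
  let T : V n →L[ℝ] V n := LinearMap.toContinuousLinearMap
    { toFun := transport n z
      map_add' := transport_add z
      map_smul' := transport_smul z }
  let Φ : E n →L[ℝ] E n := (0 : E n →L[ℝ] V n).prod
    ((((ContinuousLinearMap.snd ℝ (V n) ℝ).smulRight z.2.1 +
      T.comp (ContinuousLinearMap.fst ℝ (V n) ℝ)).prod
      (z.2.2 • ContinuousLinearMap.snd ℝ (V n) ℝ)).comp (ContinuousLinearMap.snd ℝ _ _))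
  have h : HasFDerivWithinAt (fun w => mul n z w) Φ (leftFiber n (unit n (rightBase n z)))
      (unit n (rightBase n z)) := by
    have h0 : HasFDerivWithinAt (fun w => ((z.1, 0, 0) : E n) + Φ w) Φ
        (leftFiber n (unit n (rightBase n z))) (unit n (rightBase n z)) :=
      (Φ.hasFDerivAt.const_add _).hasFDerivWithinAt
    -- On the left fibre over the right unit of z, left translation by z is the restriction of an
    -- affine map with linear part Φ.
    refine h0.congr' ?_ ?_
    · intro w hw
      rw [mem_leftFiber_iff hn] at hw
      beta_reduce
      rw [mul_eq hn hz hw.1 hw.2]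
      simp [Φ, T]
    · rw [mem_leftFiber_iff hn]
      exact ⟨unit_mem hq, rfl⟩
  rw [leftInvariant, eR_eq hn hz]
  change fderivWithin _ _ _ _ (trivInv n (rightBase n z) w) = _
  rw [fderivWithin_apply_of_mem_tangentConeAt h
    (mem_algebroidFiber_trivInv hn hq w)]
  have hP : transport n z (P n (rightBase n z) w) =
      transport n z w - ⟪w, rightBase n z⟫ • (z.2.2 • z.1 - z.2.1) := by
    rw [P, sub_eq_add_neg, ← neg_smul, transport_add, transport_smul, hT, neg_smul,
      ← sub_eq_add_neg]
  simp only [trivInv, invField, Φ, T]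
  simp [hP]
  module

lemma X_eq_constSection (i : Idx n) : X n i = constSection n (e n i) := by
  ext1 ε
  simp [X, constSection, trivInv, P, e, EuclideanSpace.inner_single_left]

lemma contDiff_apply (i : Idx n) : ContDiff ℝ ∞ (fun v : V n => v i) :=
  (EuclideanSpace.proj (𝕜 := ℝ) i).contDiff

/-! ### Smoothness of the coordinate formulas at points of Z -/

section Smooth

variable {z : E n}

lemma contDiffAt_inner_self : ContDiffAt ℝ ∞ (fun z : E n => ⟪z.2.1, z.2.1⟫) z :=
  ContDiffAt.inner ℝ (by fun_prop) (by fun_prop)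

lemma contDiffAt_timePart (hz : z ∈ Z n) : ContDiffAt ℝ ∞ (timePart n) z := by
  have hs := hz.2.2
  have h := contDiffAt_inner_self (z := z)
  exact ContDiffAt.div (by fun_prop) (by fun_prop) (by positivity)

lemma contDiffAt_spacePart (hz : z ∈ Z n) : ContDiffAt ℝ ∞ (spacePart n) z := by
  have hs := hz.2.2
  have h := contDiffAt_inner_self (z := z)
  have h' : ContDiffAt ℝ ∞
      (fun z : E n => (z.2.2 ^ 2 - 1 - ⟪z.2.1, z.2.1⟫) / (2 * z.2.2)) z :=
    ContDiffAt.div (by fun_prop) (by fun_prop) (by positivity)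
  unfold spacePart
  fun_prop

lemma contDiffAt_spacePart_apply (hz : z ∈ Z n) (i : Idx n) :
    ContDiffAt ℝ ∞ (fun z => spacePart n z i) z :=
  (contDiff_apply i).contDiffAt.comp z (contDiffAt_spacePart hz)

lemma contDiffAt_scale (hz : z ∈ Z n) : ContDiffAt ℝ ∞ (scale n) z :=
  (contDiffAt_timePart hz).add (contDiffAt_spacePart_apply hz _)

lemma contDiffAt_rightBase (hz : z ∈ Z n) : ContDiffAt ℝ ∞ (rightBase n) z := by
  have hs := hz.2.2
  have h1 := contDiffAt_timePart hz
  have h2 := contDiffAt_spacePart hz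
  have h3 := contDiffAt_scale hz
  have h4 : ContDiffAt ℝ ∞ (fun z : E n => z.1 (Sum.inr ())) z :=
    (contDiff_apply _).contDiffAt.comp z (by fun_prop)
  have h5 := (scale_pos hz).ne'
  unfold rightBase
  have h6 : ContDiffAt ℝ ∞ (fun z : E n => z.2.2⁻¹) z := ContDiffAt.inv (by fun_prop) hs.ne'
  have h7 : ContDiffAt ℝ ∞ (fun z : E n => (1 - z.1 (Sum.inr ())) / scale n z) z :=
    ContDiffAt.div (by fun_prop) h3 h5
  fun_prop

lemma contDiffAt_transport (hz : z ∈ Z n) (w : V n) :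
    ContDiffAt ℝ ∞ (fun z => transport n z w) z := by
  have h2 := contDiffAt_spacePart hz
  have h2' := contDiffAt_spacePart_apply hz (Sum.inr ())
  have h3 := contDiffAt_scale hz
  have h5 := (scale_pos hz).ne'
  unfold transport
  have h4 : ContDiffAt ℝ ∞ (fun z => ⟪spacePart n z, w⟫) z := h2.inner ℝ contDiffAt_const
  have h7 : ContDiffAt ℝ ∞ (fun z : E n => (w (Sum.inr ()) * (1 + spacePart n z (Sum.inr ())) -
      ⟪spacePart n z, w⟫) / scale n z) z :=
    ContDiffAt.div (by fun_prop) h3 h5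
  fun_prop

lemma contDiffAt_invField (hz : z ∈ Z n) (w : V n) : ContDiffAt ℝ ∞ (invField n w) z := by
  have h1 := contDiffAt_transport hz w
  have h2 : ContDiffAt ℝ ∞ (fun z => ⟪w, rightBase n z⟫) z :=
    contDiffAt_const.inner ℝ (contDiffAt_rightBase hz)
  unfold invField
  fun_prop

end Smooth

@[simp] lemma unit_fst (p : V n) : (unit n p).1 = p := rfl
@[simp] lemma unit_snd_fst (p : V n) : (unit n p).2.1 = 0 := rfl
@[simp] lemma unit_snd_snd (p : V n) : (unit n p).2.2 = 1 := rfl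

/-! ### Derivatives at the units, in the directions of the left fibres -/

section Derivatives

variable (p v : V n) (r : ℝ)

/-- A line through the unit `(p, 0, 1)` along the left fibre. -/
def fiberLine (t : ℝ) : E n := (p, t • v, 1 + t * r)

lemma hasDerivAt_fiberLine : HasDerivAt (fiberLine p v r) (0, v, r) 0 := by
  have h1 : HasDerivAt (fun t : ℝ => t • v) v 0 := by
    simpa using (hasDerivAt_id (0 : ℝ)).smul_const v
  have h2 : HasDerivAt (fun t : ℝ => 1 + t * r) r 0 := by
    simpa using ((hasDerivAt_id (0 : ℝ)).mul_const r).const_add 1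
  exact (hasDerivAt_const _ _).prodMk (h1.prodMk h2)

@[simp] lemma fiberLine_zero : fiberLine p v r 0 = unit n p := by simp [fiberLine, unit]

lemma hasDerivAt_fiberLine_snd : HasDerivAt (fun t => (fiberLine p v r t).2.1) v 0 :=
  (hasDerivAt_fiberLine p v r).snd.fst

lemma hasDerivAt_fiberLine_thd : HasDerivAt (fun t => (fiberLine p v r t).2.2) r 0 :=
  (hasDerivAt_fiberLine p v r).snd.snd

lemma hasDerivAt_inner_self :
    HasDerivAt (fun t => ⟪(fiberLine p v r t).2.1, (fiberLine p v r t).2.1⟫) 0 0 := by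
  simpa using (hasDerivAt_fiberLine_snd p v r).inner ℝ (hasDerivAt_fiberLine_snd p v r)

/-- The function (s² + 1)/(2s) is critical at s = 1, and |v|² vanishes to second order. -/
lemma hasDerivAt_timePart : HasDerivAt (fun t => timePart n (fiberLine p v r t)) 0 0 := by
  have h1 := hasDerivAt_fiberLine_thd p v r
  have h := (((h1.pow 2).add_const 1).add (hasDerivAt_inner_self p v r)).div (h1.const_mul 2)
    (by simp)
  refine h.congr_deriv ?_
  simp
  ring

lemma hasDerivAt_spacePart :
    HasDerivAt (fun t => spacePart n (fiberLine p v r t)) (r • p - v) 0 := by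
  have h1 := hasDerivAt_fiberLine_thd p v r
  have h := (((h1.pow 2).sub_const 1).sub (hasDerivAt_inner_self p v r)).div (h1.const_mul 2)
    (by simp)
  refine ((h.smul_const p).sub (hasDerivAt_fiberLine_snd p v r)).congr_deriv ?_
  simp
  congr 1
  ring

lemma hasDerivAt_apply {f : ℝ → V n} {f' : V n} {t : ℝ} (h : HasDerivAt f f' t) (i : Idx n) :
    HasDerivAt (fun t => f t i) (f' i) t :=
  (EuclideanSpace.proj (𝕜 := ℝ) i).hasFDerivAt.comp_hasDerivAt t h

lemma hasDerivAt_scale : HasDerivAt (fun t => scale n (fiberLine p v r t))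
    ((r • p - v) (Sum.inr ())) 0 := by
  refine ((hasDerivAt_timePart p v r).add
    (hasDerivAt_apply (hasDerivAt_spacePart p v r) (Sum.inr ()))).congr_deriv ?_
  simp

/-- This derivative is the anchor evaluated on the vector (0, v, r). -/
lemma hasDerivAt_rightBase : HasDerivAt (fun t => rightBase n (fiberLine p v r t))
    (r • (e n (Sum.inr ()) - p (Sum.inr ()) • p) - (1 - p (Sum.inr ())) • v) 0 := by
  have h1 := hasDerivAt_fiberLine_thd p v r
  have h2 := hasDerivAt_timePart p v r
  have h3 := hasDerivAt_spacePart p v r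
  have h4 := hasDerivAt_scale p v r
  have h := (h1.inv (by simp)).smul
    ((((h1.sub_const 1).smul_const (e n (Sum.inr ()))).const_add p).add
      (((hasDerivAt_const (0 : ℝ) (1 - p (Sum.inr ()))).div h4 (by simp)).smul
        (h3.add ((h2.sub_const 1).smul_const (e n (Sum.inr ()))))))
  refine h.congr_deriv ?_
  simp
  module

lemma hasDerivAt_transport (w : V n) : HasDerivAt (fun t => transport n (fiberLine p v r t) w)
    (w (Sum.inr ()) • (r • p - v) - ⟪r • p - v, w⟫ • (e n (Sum.inr ()) - p)) 0 := by
  have h1 := hasDerivAt_fiberLine_thd p v r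
  have h1' := hasDerivAt_fiberLine_snd p v r
  have h3 := hasDerivAt_spacePart p v r
  have h3' := hasDerivAt_apply h3 (Sum.inr ())
  have h4 := hasDerivAt_scale p v r
  have h := ((((h1.smul_const p).sub h1').sub_const (e n (Sum.inr ()))).const_smul
      (w (Sum.inr ()))).const_add w |>.add
    (((((h3'.const_add 1).const_mul (w (Sum.inr ()))).sub
      (h3.inner ℝ (hasDerivAt_const (0 : ℝ) w))).div h4 (by simp)).smul_const
        (e n (Sum.inr ()) - p))
  refine h.congr_deriv ?_
  simp
  module

lemma hasDerivAt_invField (w : V n) : HasDerivAt (fun t => invField n w (fiberLine p v r t))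
    (0, w (Sum.inr ()) • (r • p - v) - ⟪r • p - v, w⟫ • (e n (Sum.inr ()) - p) +
        ⟪w, p⟫ • ((2 : ℝ) • v - r • p) -
        ⟪w, r • (e n (Sum.inr ()) - p (Sum.inr ()) • p) - (1 - p (Sum.inr ())) • v⟫ • p,
      r * ⟪w, p⟫ +
        ⟪w, r • (e n (Sum.inr ()) - p (Sum.inr ()) • p) - (1 - p (Sum.inr ())) • v⟫) 0 := by
  have h1 := hasDerivAt_fiberLine_thd p v r
  have h1' := hasDerivAt_fiberLine_snd p v r
  have h2 := (hasDerivAt_const (0 : ℝ) w).inner ℝ (hasDerivAt_rightBase p v r)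
  have h := (hasDerivAt_const (0 : ℝ) (0 : V n)).prodMk (((hasDerivAt_transport p v r w).add
    (h2.smul ((h1'.const_smul (2 : ℝ)).sub (h1.smul_const p)))).prodMk (h1.mul h2))
  refine h.congr_deriv ?_
  refine Prod.ext rfl (Prod.ext ?_ ?_)
  · simp
    module
  · simp

end Derivatives

/-- The tangent map at a unit of a smooth map on `Z`, from its restriction to a line. -/
lemma fderivWithin_unit_apply {p v : V n} {r : ℝ} {f g : E n → E n} {g' : E n}
    (hp : ‖p‖ = 1) (hg : ContDiffAt ℝ ∞ g (unit n p)) (hfg : Set.EqOn f g (Z n))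
    (hv : ((0, v, r) : E n) ∈ algebroidFiber n p)
    (h : HasDerivAt (fun t => g (fiberLine p v r t)) g' 0) :
    fderivWithin ℝ f (Z n) (unit n p) (0, v, r) = g' := by
  have hd := (hg.differentiableAt (by simp)).hasFDerivAt
  rw [fderivWithin_apply_of_mem_tangentConeAt
    (hd.hasFDerivWithinAt.congr' hfg (unit_mem hp)) (algebroidFiber_subset p hv)]
  rw [← fiberLine_zero p v r] at hd
  have := hd.comp_hasDerivAt (0 : ℝ) (hasDerivAt_fiberLine p v r)
  rw [fiberLine_zero] at this
  exact this.unique h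

/-- The bracket of two constant sections. -/
theorem bracket_constSection (hn : 0 < n) {p : V n} (hp : ‖p‖ = 1) (w w' : V n) :
    bracket n (constSection n w) (constSection n w') p =
      (0, (2 : ℝ) • (⟪w', p⟫ • w - ⟪w, p⟫ • w') + w' (Sum.inr ()) • (⟪w, p⟫ • p - w) -
          w (Sum.inr ()) • (⟪w', p⟫ • p - w'),
        ⟪w, p⟫ * w' (Sum.inr ()) - ⟪w', p⟫ * w (Sum.inr ())) := by
  have hz := unit_mem hp
  have hval : ∀ w : V n, leftInvariant n (constSection n w) (unit n p) =
      (0, w - ⟪w, p⟫ • p, ⟪w, p⟫) := by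
    intro w
    rw [leftInvariant_constSection hn w hz]
    simp [invField, unit]
    simp only [← unit.eq_1, transport_unit, rightBase_unit]
    simp [sub_eq_add_neg]
  -- At a unit the fields take values in the tangent space of the left fibre, so both terms of the
  -- commutator are derivatives of `invField` along fibre lines, with direction `trivInv` of the
  -- other vector.
  have hD : ∀ w w' : V n, _ := fun w w' => fderivWithin_unit_apply hp (contDiffAt_invField hz w)
    (fun z hz => leftInvariant_constSection hn w hz) (mem_algebroidFiber_trivInv hn hp w')
    (hasDerivAt_invField p (P n p w') ⟪w', p⟫ w)
  have hE : ∀ w : V n, ⟪w, e n (Sum.inr ())⟫ = w (Sum.inr ()) := by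
    intro w; simp [e, EuclideanSpace.inner_single_right]
  unfold bracket
  rw [VectorField.lieBracketWithin_eq]
  simp only [hval]
  simp only [P] at hD
  rw [hD, hD]
  simp only [Prod.mk_sub_mk, sub_zero]
  simp only [inner_sub_left, inner_sub_right, real_inner_smul_left, real_inner_smul_right, hE,
    real_inner_comm w p, real_inner_comm w' p, real_inner_comm w w']
  refine Prod.ext rfl (Prod.ext ?_ ?_)
  · simp only
    module
  · simp only
    ring

/-- The anchor on constant sections. -/
theorem anchor_trivInv (hn : 0 < n) {p : V n} (hp : ‖p‖ = 1) (w : V n) :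
    anchor n p (trivInv n p w) =
      (⟪w, p⟫ • (e n (Sum.inr ()) - p (Sum.inr ()) • p) - (1 - p (Sum.inr ())) • P n p w, 0, 0) := by
  have hz := unit_mem hp
  have h0 : ContDiffAt ℝ ∞ (fun z => unit n (rightBase n z)) (unit n p) := by
    have := contDiffAt_rightBase hz
    unfold unit at this ⊢
    fun_prop
  exact fderivWithin_unit_apply hp h0 (fun z hz => eR_eq hn hz)
    (mem_algebroidFiber_trivInv hn hp w)
    ((hasDerivAt_rightBase p _ _).prodMk (hasDerivAt_const _ _))

lemma triv_trivInv (p w : V n) : triv n p (trivInv n p w) = w := by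
  simp [triv, trivInv, P]

lemma trivInv_triv (hn : 0 < n) {p : V n} (hp : ‖p‖ = 1) {w : E n} (hw : w ∈ algebroidFiber n p) :
    trivInv n p (triv n p w) = w := by
  rw [algebroidFiber_eq hn hp] at hw
  obtain ⟨w₁, w₂, w₃⟩ := w
  obtain ⟨h1, h2⟩ := hw
  simp only at h1 h2
  have : ⟪w₂ + w₃ • p, p⟫ = w₃ := by
    rw [inner_add_left, real_inner_smul_left, real_inner_self_eq_norm_sq, hp, real_inner_comm, h2]
    ring
  simp [trivInv, triv, P, this, h1]

end EuclideanLines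

end

open EuclideanLines in
theorem proposition4p2 (n : ℕ) (hn : 2 ≤ n) :
    -- the structure maps of the groupoid `Z` are well defined
    (∀ z ∈ Z n, ∃! ε, ε ∈ units n ∧ MulRel n z ε z) ∧
    (∀ z ∈ Z n, ∃! ε, ε ∈ units n ∧ MulRel n z z ε) ∧
    (∀ z ∈ Z n, ∀ w ∈ Z n, eR n z = eL n w → ∃! z₃, MulRel n z₃ z w) ∧
    -- the right projection and the left invariant extensions of the basis sections are smooth
    ContDiffOn ℝ ∞ (eR n) (Z n) ∧
    (∀ i : Idx n, ContDiffOn ℝ ∞ (leftInvariant n (X n i)) (Z n)) ∧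
    ∀ p ∈ Metric.sphere (0 : V n) 1,
      -- `L(Z)` is `TSⁿ ⊕ ℝ`, it is trivialized by `triv`, and the `X_i` are a basis of sections
      algebroidFiber n p = {w | w.1 = 0 ∧ ⟪p, w.2.1⟫ = 0} ∧
      Set.InvOn (trivInv n p) (triv n p) (algebroidFiber n p) Set.univ ∧
      Set.BijOn (triv n p) (algebroidFiber n p) Set.univ ∧
      LinearIndependent ℝ (fun i => X n i (unit n p)) ∧
      (Submodule.span ℝ (Set.range fun i => X n i (unit n p)) : Set (E n)) =
        algebroidFiber n p ∧
      -- the bracket of the basis sections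
      (∀ i j : Fin n,
        bracket n (X n (Sum.inl i)) (X n (Sum.inl j)) p =
          (2 : ℝ) • (p (Sum.inl j) • X n (Sum.inl i) (unit n p)
            - p (Sum.inl i) • X n (Sum.inl j) (unit n p))) ∧
      (∀ i : Fin n,
        bracket n (X n (Sum.inl i)) (X n (Sum.inr ())) p =
          (2 : ℝ) • (p (Sum.inr ()) • X n (Sum.inl i) (unit n p)
            - p (Sum.inl i) • X n (Sum.inr ()) (unit n p))
          - X n (Sum.inl i) (unit n p)
          + (2 * p (Sum.inl i)) • ∑ k : Idx n, p k • X n k (unit n p)) ∧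
      -- the anchor on the basis sections
      (∀ i : Idx n,
        anchor n p (X n i (unit n p)) =
          (-(1 - p (Sum.inr ())) • (e n i - p i • p)
            + p i • (e n (Sum.inr ()) - p (Sum.inr ()) • p), 0, 0)) ∧
      (∀ i : Idx n,
        anchor n p (X n i (unit n p)) =
          (P n p (p i • e n (Sum.inr ()) + p (Sum.inr ()) • e n i - e n i), 0, 0)) ∧
      -- the same in terms of constant sections of `Sⁿ × ℝⁿ⁺¹`
      (∀ i j : Fin n,
        triv n p (bracket n (constSection n (e n (Sum.inl i)))
            (constSection n (e n (Sum.inl j))) p) =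
          (2 : ℝ) • (p (Sum.inl j) • e n (Sum.inl i) - p (Sum.inl i) • e n (Sum.inl j))) ∧
      (∀ i : Fin n,
        triv n p (bracket n (constSection n (e n (Sum.inl i)))
            (constSection n (e n (Sum.inr ()))) p) =
          (2 : ℝ) • (p (Sum.inr ()) • e n (Sum.inl i) - p (Sum.inl i) • e n (Sum.inr ()))
          + (e n (Sum.inl i) - (2 : ℝ) • P n p (e n (Sum.inl i)))) ∧
      (∀ w : V n,
        anchor n p (trivInv n p w) =
          (-(1 - p (Sum.inr ())) • P n p w + ⟪p, w⟫ • P n p (e n (Sum.inr ())), 0, 0)) ∧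
      (∀ w : V n,
        anchor n p (trivInv n p w) =
          (P n p (⟪p, e n (Sum.inr ())⟫ • w + ⟪p, w⟫ • e n (Sum.inr ()) - w), 0, 0)) := by
  have hn0 : 0 < n := by omega
  have hinner : ∀ (i : Idx n) (p : V n), ⟪e n i, p⟫ = p i := by
    intro i p; simp [e, EuclideanSpace.inner_single_left]
  have hX : ∀ (i : Idx n) (p : V n), X n i (unit n p) = trivInv n p (e n i) := by
    intro i p; rw [X_eq_constSection]; rfl
  have he : ∀ i : Fin n, e n (Sum.inl i) (Sum.inr ()) = 0 := by intro i; simp [e]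
  refine ⟨fun z hz => ?_, fun z hz => ?_, fun z hz w hw h => ?_, fun z hz => ?_,
    fun i z hz => ?_, fun p hp => ?_⟩
  · simp only [isUnit_left_iff hn0 hz, existsUnique_eq]
  · simp only [isUnit_right_iff hn0 hz, existsUnique_eq]
  · rw [eR_eq hn0 hz, eL_eq hn0 hw, unit_injective.eq_iff] at h
    simp only [mulRel_iff_of_mem hn0 hz hw h.symm, existsUnique_eq]
  · have h := contDiffAt_rightBase hz
    have h' : ContDiffAt ℝ ∞ (fun z => unit n (rightBase n z)) z := by
      unfold unit
      fun_prop
    exact h'.contDiffWithinAt.congr (fun z hz => eR_eq hn0 hz) (eR_eq hn0 hz)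
  · rw [X_eq_constSection]
    exact (contDiffAt_invField hz _).contDiffWithinAt.congr
      (fun z hz => leftInvariant_constSection hn0 _ hz) (leftInvariant_constSection hn0 _ hz)
  have hp1 : ‖p‖ = 1 := by simpa using hp
  have hinv : Set.InvOn (trivInv n p) (triv n p) (algebroidFiber n p) Set.univ :=
    ⟨fun w hw => trivInv_triv hn0 hp1 hw, fun w _ => triv_trivInv p w⟩
  let T : V n →ₗ[ℝ] E n :=
    { toFun := trivInv n p
      map_add' := fun v w => by
        simp only [trivInv, P, inner_add_left, Prod.mk_add_mk, add_zero]
        congr 2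
        module
      map_smul' := fun c w => by
        simp only [trivInv, P, real_inner_smul_left, Prod.smul_mk, smul_zero, RingHom.id_apply,
          smul_eq_mul]
        congr 2
        module }
  have hT : ∀ w, T w = trivInv n p w := fun _ => rfl
  have hTker : LinearMap.ker T = ⊥ :=
    LinearMap.ker_eq_bot.mpr (Function.LeftInverse.injective (triv_trivInv p))
  -- The X_i are the image of the standard basis under the injective linear map T, whose range is
  -- the fibre; both basis claims follow.
  have hXT : (fun i => X n i (unit n p)) = T ∘ (EuclideanSpace.basisFun (Idx n) ℝ).toBasis := by
    ext1 i
    simp [hX, hT, e]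
  have hanchor₁ : ∀ w : V n, anchor n p (trivInv n p w) =
      (-(1 - p (Sum.inr ())) • P n p w + ⟪p, w⟫ • P n p (e n (Sum.inr ())), 0, 0) := by
    intro w
    rw [anchor_trivInv hn0 hp1]
    congr 1
    simp only [P, hinner, real_inner_comm p w]
    module
  have hanchor₂ : ∀ w : V n, anchor n p (trivInv n p w) =
      (P n p (⟪p, e n (Sum.inr ())⟫ • w + ⟪p, w⟫ • e n (Sum.inr ()) - w), 0, 0) := by
    intro w
    rw [hanchor₁]
    congr 1
    simp only [P, inner_sub_left, inner_add_left, real_inner_smul_left, hinner,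
      real_inner_comm p w, real_inner_comm (e n (Sum.inr ())) p]
    module
  refine ⟨algebroidFiber_eq hn0 hp1, hinv, ?_, ?_, ?_, ?_, ?_, ?_, ?_, ?_, ?_, hanchor₁, hanchor₂⟩
  · exact hinv.bijOn (fun _ _ => trivial) (fun w _ => mem_algebroidFiber_trivInv hn0 hp1 w)
  · rw [hXT]
    exact (EuclideanSpace.basisFun (Idx n) ℝ).toBasis.linearIndependent.map' T hTker
  · rw [hXT, Set.range_comp, ← Submodule.map_span, Module.Basis.span_eq, Submodule.map_top]
    ext w
    constructor
    · rintro ⟨v, rfl⟩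
      exact mem_algebroidFiber_trivInv hn0 hp1 v
    · intro hw
      exact ⟨triv n p w, trivInv_triv hn0 hp1 hw⟩
  · intro i j
    rw [X_eq_constSection, X_eq_constSection, bracket_constSection hn0 hp1]
    simp only [hinner, he, constSection, trivInv, P, unit]
    refine Prod.ext (by simp) (Prod.ext ?_ ?_)
    · simp; module
    · simp; ring
  · intro i
    -- The sum is `trivInv` applied to p = ∑ pᵏ e_k, that is, the unit vector in the s-direction.
    have hsum : ∑ k : Idx n, p k • X n k (unit n p) = (0, 0, 1) := by
      have h1 : ∑ k : Idx n, p k • e n k = p := by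
        simpa [e] using (EuclideanSpace.basisFun (Idx n) ℝ).sum_repr p
      simp only [hX, ← hT, ← map_smul]
      rw [← map_sum, h1, hT]
      simp [trivInv, P, hp1]
    rw [hsum, X_eq_constSection, X_eq_constSection, bracket_constSection hn0 hp1]
    simp only [hinner, he, constSection, trivInv, P, unit]
    refine Prod.ext (by simp) (Prod.ext ?_ ?_)
    · simp; module
    · simp; ring
  · intro i
    rw [hX, hanchor₁]
    simp only [P, hinner, real_inner_comm (e n i) p]
  · intro i
    rw [hX, hanchor₂]
    simp only [hinner, real_inner_comm (e n i) p, real_inner_comm (e n (Sum.inr ())) p]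
    rw [add_comm (p i • _)]
  · intro i j
    rw [bracket_constSection hn0 hp1]
    simp only [hinner, he, triv]
    simp
  · intro i
    rw [bracket_constSection hn0 hp1]
    simp only [hinner, he, triv, P]
    simp
    module
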